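/- Let $X$ be a separable metric space. Write $\mathrm{Lip}(X)$ for the real-valued Lipschitz functions on $X$, $\mathrm{Lip}(\pi)$ for the Lipschitz constant of $\pi$, and $\mathrm{Lip}_b(X)$ for the bounded Lipschitz functions. **Currents.** A metric $1$-current on $X$ is a bilinear map $T:\mathrm{Lip}_b(X)\times\mathrm{Lip}(X)\to\mathbb R$ such that 1. there is a finite Borel measure $\mu$ on $X$ with $|T(f,\pi)|\le \mathrm{Lip}(\pi)\int_X|f|\,d\mu$ for all $f,\pi$; the least such measure is denoted $\|T\|$, and $\mathbf M(T)=\|T\|(X)$; 2. $T(f,\pi_j)\to T(f,\pi)$ whenever $\pi_j\to\pi$ pointwise and $\sup_j\mathrm{Lip}(\pi_j)<\infty$; 3. $T(f,\pi)=0$ if $\pi$ is constant on a neighbourhood of the support of $f$. The set of these currents is $\mathbf M_1(X)$. The boundary of $T$ is $\partial T(f)=T(1,f)$ for $f\in\mathrm{Lip}(X)$, and $\|\partial T\|_{KR}=\sup\{\partial T(f): f \text{ is } 1\text{-Lipschitz}\}$. **Rectifiability.** A set $E\subset X$ is $1$-rectifiable if it is the image of a bounded subset of $\mathbb R$ under a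 Lipschitz map. A current $R\in\mathbf M_1(X)$ is rectifiable if $\|R\|$ is concentrated on a countable union of $1$-rectifiable sets and $\|R\|$ is absolutely continuous with respect to the Hausdorff measure $\mathcal H^1$. **Piecewise quasiconvexity.** $X$ is piecewise quasiconvex with constant $c\ge1$ if for all $x,y\in X$ and $\varepsilon>0$ there are $m\ge1$, pairs of points $(x_1,y_1),\dots,(x_m,y_m)$ in $X$ and Lipschitz curves $\theta_1,\dots,\theta_m:[0,1]\to X$ with $\theta_i(0)=x_i$, $\theta_i(1)=y_i$, $$d(x,x_1)+d(y_m,y)+\sum_{i=1}^{m-1}d(x_{i+1},y_i)<\varepsilon,\qquad \sum_{i=1}^m\ell(\theta_i)\le c\,d(x,y),$$ where $\ell(\theta)=\int_0^1|\dot\theta|(t)\,dt$ and $|\dot\theta|(t)=\limsup_{h\to0^+}d(\theta(t+h),\theta(t))/h$. **Lemma (Almost optimal primitives).** Let $X$ be a separable metric space that is piecewise quasiconvex with constant $c\ge 1$, and let $T\in\mathbf M_1(X)$. Then for every $\delta\in(0,1)$ there is a rectifiable current $R\in\mathbf M_1(X)$ such that $$\partial R=\partial T\qquad\text{and}\qquad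 \mathbf M(R)\le c(1+\delta)\,\|\partial T\|_{KR}.$$ -/

import Mathlib

open MeasureTheory Filter Topology
open scoped NNReal ENNReal

noncomputable section

namespace MetricCurrents

/-- `Lip(X)`: the real vector space of real-valued Lipschitz functions on `X`. -/
def Lip (X : Type*) [MetricSpace X] : Submodule ℝ (X → ℝ) where
  carrier := {f | ∃ K : ℝ≥0, LipschitzWith K f}
  add_mem' := by
    rintro f g ⟨K, hK⟩ ⟨L, hL⟩
    exact ⟨K + L, hK.add hL⟩
  zero_mem' := ⟨0, LipschitzWith.const 0⟩
  smul_mem' := by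
    rintro a f ⟨K, hK⟩
    exact ⟨‖a‖₊ * K, (lipschitzWith_smul a).comp hK⟩

/-- `Lip_b(X)`: the real vector space of bounded real-valued Lipschitz functions on `X`. -/
def LipB (X : Type*) [MetricSpace X] : Submodule ℝ (X → ℝ) where
  carrier := {f | (∃ K : ℝ≥0, LipschitzWith K f) ∧ ∃ C : ℝ, ∀ x, |f x| ≤ C}
  add_mem' := by
    rintro f g ⟨hf, C, hC⟩ ⟨hg, D, hD⟩
    exact ⟨(Lip X).add_mem hf hg, C + D,
      fun x => (abs_add_le (f x) (g x)).trans (add_le_add (hC x) (hD x))⟩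
  zero_mem' := ⟨(Lip X).zero_mem, 0, fun x => by simp⟩
  smul_mem' := by
    rintro a f ⟨hf, C, hC⟩
    refine ⟨(Lip X).smul_mem a hf, |a| * C, fun x => ?_⟩
    simpa [abs_mul] using mul_le_mul_of_nonneg_left (hC x) (abs_nonneg a)

/-- The constant function `1`, as a bounded Lipschitz function. -/
def oneB (X : Type*) [MetricSpace X] : LipB X :=
  ⟨fun _ => 1, ⟨0, LipschitzWith.const 1⟩, 1, fun x => by simp⟩

variable {X : Type*} [MetricSpace X] [MeasurableSpace X] [BorelSpace X]

/-- The finite Borel measures `μ` with `|T(f, π)| ≤ Lip(π) ∫ |f| dμ` for all `(f, π)`. Here `Lip(π)`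
is the least admissible Lipschitz constant, so the inequality is imposed for every admissible
constant `K`. -/
def massBounds (T : LipB X →ₗ[ℝ] Lip X →ₗ[ℝ] ℝ) : Set (Measure X) :=
  {μ | IsFiniteMeasure μ ∧ ∀ (f : LipB X) (π : Lip X) (K : ℝ≥0), LipschitzWith K (π : X → ℝ) →
    |T f π| ≤ K * ∫ x, |(f : X → ℝ) x| ∂μ}

/-- Metric `1`-currents on `X`: bilinear functionals on `Lip_b(X) × Lip(X)` of finite mass that are
continuous in the second argument and local. -/
structure Current₁ (X : Type*) [MetricSpace X] [MeasurableSpace X] [BorelSpace X] where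
  toFun : LipB X →ₗ[ℝ] Lip X →ₗ[ℝ] ℝ
  finite_mass : (massBounds toFun).Nonempty
  continuity : ∀ (f : LipB X) (π : Lip X) (πs : ℕ → Lip X) (C : ℝ≥0),
    (∀ j, LipschitzWith C (πs j : X → ℝ)) →
    (∀ x, Tendsto (fun j => (πs j : X → ℝ) x) atTop (𝓝 ((π : X → ℝ) x))) →
    Tendsto (fun j => toFun f (πs j)) atTop (𝓝 (toFun f π))
  locality : ∀ (f : LipB X) (π : Lip X) (U : Set X) (a : ℝ), IsOpen U →
    tsupport (f : X → ℝ) ⊆ U → (∀ x ∈ U, (π : X → ℝ) x = a) → toFun f π = 0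

namespace Current₁

/-- The mass measure `‖T‖`: the minimal finite Borel measure `μ` with
`|T(f, π)| ≤ Lip(π) ∫ |f| dμ`. (Infimum in the complete lattice of Borel measures; it is attained,
see `isLeast_massMeasure`.) -/
def massMeasure (T : Current₁ X) : Measure X := sInf (massBounds T.toFun)

/-- The mass `M(T) = ‖T‖(X)`. -/
def mass (T : Current₁ X) : ℝ≥0∞ := T.massMeasure Set.univ

/-- The boundary `∂T(f) = T(1, f)`. It makes sense for all Lipschitz `f`, bounded or not. -/
def boundary (T : Current₁ X) : Lip X →ₗ[ℝ] ℝ := T.toFun (oneB X)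

/-- The Kantorovich-Rubinstein norm `‖∂T‖_KR = sup {∂T(f) : f is 1-Lipschitz}`. The supremum is
nonnegative because of `f = 0`, so negative values may be truncated. -/
def boundaryKR (T : Current₁ X) : ℝ≥0∞ :=
  ⨆ (f : Lip X) (_ : LipschitzWith 1 (f : X → ℝ)), ENNReal.ofReal (T.boundary f)

end Current₁

theorem continuous_lipB {X : Type*} [MetricSpace X] (f : LipB X) : Continuous (f : X → ℝ) := by
  obtain ⟨⟨K, hK⟩, -⟩ := f.2
  exact hK.continuous

theorem memLp_lipB (f : LipB X) (μ : Measure X) [IsFiniteMeasure μ] (p : ℝ≥0∞) :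
    MemLp (f : X → ℝ) p μ := by
  obtain ⟨-, C, hC⟩ := f.2
  exact MemLp.of_bound (continuous_lipB f).aestronglyMeasurable C (ae_of_all _ hC)

theorem exists_dual_extension {V E : Type*} [AddCommGroup V] [Module ℝ V] [NormedAddCommGroup E]
    [NormedSpace ℝ E] (ι : V →ₗ[ℝ] E) (φ : V →ₗ[ℝ] ℝ) (C : ℝ)
    (hb : ∀ f, |φ f| ≤ C * ‖ι f‖) : ∃ Ψ : StrongDual ℝ E, ∀ f, Ψ (ι f) = φ f := by
  obtain ⟨s, hs⟩ := ι.rangeRestrict.exists_rightInverse_of_surjective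
    (LinearMap.range_rangeRestrict ι)
  have hs' : ∀ y, ι (s y) = y := fun y => congrArg Subtype.val (LinearMap.congr_fun hs y)
  let ψ : StrongDual ℝ (LinearMap.range ι) := (φ ∘ₗ s).mkContinuous C (fun y => by
    simpa [hs' y] using hb (s y))
  obtain ⟨Ψ, hΨ, -⟩ := exists_extension_norm_eq (LinearMap.range ι) ψ
  refine ⟨Ψ, fun f => ?_⟩
  rw [hΨ ⟨ι f, LinearMap.mem_range_self ι f⟩]
  change φ (s ⟨ι f, _⟩) = φ f
  have h2 := hb (f - s ⟨ι f, LinearMap.mem_range_self ι f⟩)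
  rw [map_sub, map_sub, hs', sub_self, norm_zero, mul_zero] at h2
  linarith [abs_nonpos_iff.mp h2]

/-- A linear functional bounded by `∫ |f| dν` is represented by an `L¹` density. -/
theorem exists_density (φ : LipB X →ₗ[ℝ] ℝ) (ν : Measure X) [IsFiniteMeasure ν]
    (h : ∀ f : LipB X, |φ f| ≤ ∫ x, |(f : X → ℝ) x| ∂ν) :
    ∃ g : X → ℝ, Measurable g ∧ Integrable g ν ∧
      ∀ f : LipB X, φ f = ∫ x, (f : X → ℝ) x * g x ∂ν := by
  let ι : LipB X →ₗ[ℝ] Lp ℝ 2 ν :=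
    { toFun := fun f => (memLp_lipB f ν 2).toLp _
      map_add' := fun f g => rfl
      map_smul' := fun a f => rfl }
  have hι : ∀ f : LipB X, (ι f : X → ℝ) =ᵐ[ν] f := fun f => (memLp_lipB f ν 2).coeFn_toLp
  have hone : MemLp (fun _ : X => (1 : ℝ)) 2 ν := memLp_const 1
  have hb : ∀ f : LipB X, |φ f| ≤ ‖hone.toLp _‖ * ‖ι f‖ := by
    intro f
    refine (h f).trans ?_
    have h1 : ∫ x, |(f : X → ℝ) x| ∂ν = inner ℝ (hone.toLp _) |ι f| := by
      rw [L2.inner_def]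
      refine integral_congr_ae ?_
      filter_upwards [hι f, hone.coeFn_toLp, Lp.coeFn_abs (ι f)] with x h1 h2 h3
      rw [h3, h2, h1]; simp
    rw [h1]
    refine (real_inner_le_norm _ _).trans ?_
    rw [norm_abs_eq_norm]
  obtain ⟨Ψ, hΨ⟩ := exists_dual_extension ι φ _ hb
  let G := (InnerProductSpace.toDual ℝ (Lp ℝ 2 ν)).symm Ψ
  have hG : ∀ f, φ f = ∫ x, (f : X → ℝ) x * G x ∂ν := by
    intro f
    rw [← hΨ f, ← InnerProductSpace.toDual_symm_apply, L2.inner_def]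
    refine integral_congr_ae ?_
    filter_upwards [hι f] with x hx
    simp [hx, G]
  have hGm := Lp.aestronglyMeasurable G
  refine ⟨hGm.mk G, hGm.stronglyMeasurable_mk.measurable,
    ((Lp.memLp G).integrable one_le_two).congr hGm.ae_eq_mk, fun f => (hG f).trans ?_⟩
  refine integral_congr_ae ?_
  filter_upwards [hGm.ae_eq_mk] with x hx
  rw [hx]

theorem measure_le_of_forall_lintegral_le {μ ν : Measure X} [IsFiniteMeasure μ]
    [IsFiniteMeasure ν]
    (h : ∀ f : LipB X, (∀ x, 0 ≤ (f : X → ℝ) x) →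
      ∫⁻ x, ENNReal.ofReal ((f : X → ℝ) x) ∂μ ≤ ∫⁻ x, ENNReal.ofReal ((f : X → ℝ) x) ∂ν) :
    μ ≤ ν := by
  have hF : ∀ F : Set X, IsClosed F → μ F ≤ ν F := by
    intro F hF
    have hδ : ∀ n : ℕ, (0 : ℝ) < 1 / (n + 1) := fun n => Nat.one_div_pos_of_nat
    have hlim := tendsto_one_div_add_atTop_nhds_zero_nat (𝕜 := ℝ)
    refine le_of_tendsto_of_tendsto'
      (tendsto_lintegral_thickenedIndicator_of_isClosed μ hF hδ hlim)
      (tendsto_lintegral_thickenedIndicator_of_isClosed ν hF hδ hlim) fun n => ?_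
    have hl : LipschitzWith (1 / (n + 1 : ℝ)).toNNReal⁻¹
        (fun x => (thickenedIndicator (hδ n) F x : ℝ)) := by
      have := lipschitzWith_thickenedIndicator (hδ n) F
      exact fun x y => this x y
    have := h ⟨fun x => (thickenedIndicator (hδ n) F x : ℝ), ⟨_, hl⟩, 1, fun x => by
      rw [abs_of_nonneg (NNReal.coe_nonneg _)]
      exact_mod_cast thickenedIndicator_le_one (hδ n) F x⟩ (fun x => NNReal.coe_nonneg _)
    simpa using this
  refine Measure.le_iff.2 fun A hA => ?_
  rw [hA.measure_eq_iSup_isClosed_of_ne_top (measure_ne_top _ _)]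
  exact iSup₂_le fun F hFA => iSup_le fun hFc => (hF F hFc).trans (measure_mono hFA)

theorem withDensity_pos_le (g : X → ℝ) (hg : Measurable g) (ν μ : Measure X) [IsFiniteMeasure ν]
    [IsFiniteMeasure μ] (hgi : Integrable g ν)
    (h : ∀ f : LipB X, ∫ x, (f : X → ℝ) x * g x ∂ν ≤ ∫ x, |(f : X → ℝ) x| ∂μ) :
    ν.withDensity (fun x => ENNReal.ofReal (g x)) ≤ μ := by
  have hfin : ∀ g : X → ℝ, Integrable g ν →
      IsFiniteMeasure (ν.withDensity (fun x => ENNReal.ofReal (g x))) := fun g hg =>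
    isFiniteMeasure_withDensity_ofReal hg.2
  have := hfin g hgi
  have := hfin (fun x => - g x) hgi.neg
  have key : ν.withDensity (fun x => ENNReal.ofReal (g x)) ≤
      μ + ν.withDensity (fun x => ENNReal.ofReal (-g x)) := by
    refine measure_le_of_forall_lintegral_le fun f hf => ?_
    have hfm : Measurable (f : X → ℝ) := (continuous_lipB f).measurable
    obtain ⟨-, C, hC⟩ := f.2
    have e : ∀ g : X → ℝ, Measurable g → ∫⁻ x, ENNReal.ofReal ((f : X → ℝ) x)
        ∂(ν.withDensity (fun x => ENNReal.ofReal (g x))) =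
        ∫⁻ x, ENNReal.ofReal ((f : X → ℝ) x * max (g x) 0) ∂ν := by
      intro g hg
      rw [lintegral_withDensity_eq_lintegral_mul _ hg.ennreal_ofReal hfm.ennreal_ofReal]
      refine lintegral_congr fun x => ?_
      simp only [Pi.mul_apply]
      rw [ENNReal.ofReal_mul (hf x), mul_comm]
      congr 1
      simp
    have hint : ∀ g : X → ℝ, Integrable g ν →
        Integrable (fun x => (f : X → ℝ) x * max (g x) 0) ν := fun g hg =>
      hg.pos_part.bdd_mul hfm.aestronglyMeasurable (ae_of_all _ hC)
    have hnn : ∀ g : X → ℝ, ∀ x, 0 ≤ (f : X → ℝ) x * max (g x) 0 := fun g x =>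
      mul_nonneg (hf x) (le_max_right _ _)
    have hfi : Integrable (f : X → ℝ) μ := (memLp_lipB f μ 1).integrable le_rfl
    rw [lintegral_add_measure, e _ hg, e (fun x => -g x) hg.neg,
      ← ofReal_integral_eq_lintegral_ofReal (hint g hgi) (ae_of_all _ (hnn g)),
      ← ofReal_integral_eq_lintegral_ofReal (hint (fun x => -g x) hgi.neg) (ae_of_all _ (hnn _)),
      ← ofReal_integral_eq_lintegral_ofReal hfi (ae_of_all _ hf),
      ← ENNReal.ofReal_add (integral_nonneg hf) (integral_nonneg (hnn _))]
    refine ENNReal.ofReal_le_ofReal ?_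
    have h1 := h f
    have h2 : ∫ x, (f : X → ℝ) x * g x ∂ν =
        ∫ x, (f : X → ℝ) x * max (g x) 0 ∂ν - ∫ x, (f : X → ℝ) x * max (-g x) 0 ∂ν := by
      rw [← integral_sub (hint g hgi) (hint (fun x => -g x) hgi.neg)]
      refine integral_congr_ae (ae_of_all _ fun x => ?_)
      simp only
      rw [← mul_sub]
      congr 1
      rcases le_total 0 (g x) with h0 | h0
      · rw [max_eq_left h0, max_eq_right (by linarith)]; ring
      · rw [max_eq_right h0, max_eq_left (by linarith)]; ring
    have h3 : ∫ x, |(f : X → ℝ) x| ∂μ = ∫ x, (f : X → ℝ) x ∂μ :=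
      integral_congr_ae (ae_of_all _ fun x => abs_of_nonneg (hf x))
    linarith
  refine Measure.le_iff.2 fun A hA => ?_
  have hP : MeasurableSet {x | 0 < g x} := measurableSet_lt measurable_const hg
  have h1 : ν.withDensity (fun x => ENNReal.ofReal (g x)) (A \ {x | 0 < g x}) = 0 := by
    rw [withDensity_apply _ (hA.diff hP)]
    refine (setLIntegral_congr_fun (hA.diff hP) (g := fun _ => 0) fun x hx => ?_).trans (by simp)
    exact ENNReal.ofReal_of_nonpos (not_lt.1 hx.2)
  have h2 : ν.withDensity (fun x => ENNReal.ofReal (-g x)) (A ∩ {x | 0 < g x}) = 0 := by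
    rw [withDensity_apply _ (hA.inter hP)]
    refine (setLIntegral_congr_fun (hA.inter hP) (g := fun _ => 0) fun x hx => ?_).trans (by simp)
    have : 0 < g x := hx.2
    exact ENNReal.ofReal_of_nonpos (by linarith)
  calc _ ≤ ν.withDensity (fun x => ENNReal.ofReal (g x)) (A ∩ {x | 0 < g x}) +
        ν.withDensity (fun x => ENNReal.ofReal (g x)) (A \ {x | 0 < g x}) :=
        measure_le_inter_add_sdiff _ _ _
    _ ≤ μ (A ∩ {x | 0 < g x}) + 0 := by
        rw [h1]
        refine add_le_add ?_ le_rfl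
        have := key (A ∩ {x | 0 < g x})
        rwa [Measure.add_apply, h2, add_zero] at this
    _ ≤ μ A := by
        rw [add_zero]
        exact measure_mono Set.inter_subset_left

theorem withDensity_abs_le (g : X → ℝ) (hg : Measurable g) (ν μ : Measure X) [IsFiniteMeasure ν]
    [IsFiniteMeasure μ] (hgi : Integrable g ν)
    (h : ∀ f : LipB X, |∫ x, (f : X → ℝ) x * g x ∂ν| ≤ ∫ x, |(f : X → ℝ) x| ∂μ) :
    ν.withDensity (fun x => ENNReal.ofReal |g x|) ≤ μ := by
  have h1 := withDensity_pos_le g hg ν μ hgi fun f => (le_abs_self _).trans (h f)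
  have h2 := withDensity_pos_le (fun x => -g x) hg.neg ν μ hgi.neg fun f => by
    simp only [mul_neg, integral_neg]
    exact (neg_le_abs _).trans (h f)
  have hP : MeasurableSet {x | 0 < g x} := measurableSet_lt measurable_const hg
  refine Measure.le_iff.2 fun A hA => ?_
  rw [← measure_inter_add_sdiff A hP, ← measure_inter_add_sdiff (μ := μ) A hP]
  refine add_le_add (le_trans (le_of_eq ?_) (h1 _)) (le_trans (le_of_eq ?_) (h2 _))
  · rw [withDensity_apply _ (hA.inter hP), withDensity_apply _ (hA.inter hP)]
    refine setLIntegral_congr_fun (hA.inter hP) fun x hx => ?_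
    have : 0 < g x := hx.2
    simp only [abs_of_pos this]
  · rw [withDensity_apply _ (hA.diff hP), withDensity_apply _ (hA.diff hP)]
    refine setLIntegral_congr_fun (hA.diff hP) fun x hx => ?_
    have : g x ≤ 0 := not_lt.1 hx.2
    simp only [abs_of_nonpos this]

/-- The mass measure is the least finite Borel measure that bounds `T`. -/
theorem Current₁.isLeast_massMeasure (T : Current₁ X) :
    IsLeast (massBounds T.toFun) T.massMeasure := by
  obtain ⟨ν, hν, hνb⟩ := T.finite_mass
  let L := {π : Lip X // LipschitzWith 1 (π : X → ℝ)}
  have hd : ∀ π : L, ∃ g : X → ℝ, Measurable g ∧ Integrable g ν ∧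
      ∀ f : LipB X, T.toFun f π.1 = ∫ x, (f : X → ℝ) x * g x ∂ν := fun π =>
    exists_density (T.toFun.flip π.1) ν fun f => by simpa using hνb f π.1 1 π.2
  choose g hgm hgi hg using hd
  let S : L → Measure X := fun π => ν.withDensity (fun x => ENNReal.ofReal |g π x|)
  have hup : ∀ μ ∈ massBounds T.toFun, ∀ π, S π ≤ μ := by
    rintro μ ⟨hμ, hμb⟩ π
    refine withDensity_abs_le (g π) (hgm π) ν μ (hgi π) fun f => ?_
    rw [← hg π f]
    simpa using hμb f π.1 1 π.2
  have hle : (⨆ π, S π) ≤ ν := iSup_le fun π => hup ν ⟨hν, hνb⟩ π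
  have hfin : IsFiniteMeasure (⨆ π, S π) :=
    ⟨(hle Set.univ).trans_lt (measure_lt_top ν _)⟩
  have hleast : IsLeast (massBounds T.toFun) (⨆ π, S π) := by
    refine ⟨⟨hfin, ?_⟩, fun μ hμ => iSup_le fun π => hup μ hμ π⟩
    intro f π K hK
    have hS : ∀ π : L, |T.toFun f π.1| ≤ ∫ x, |(f : X → ℝ) x| ∂(⨆ π, S π) := by
      intro π
      have h1 : ∫ x, |(f : X → ℝ) x| ∂(S π) = ∫ x, |g π x| * |(f : X → ℝ) x| ∂ν := by
        refine (integral_withDensity_eq_integral_toReal_smul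
          (hgm π).abs.ennreal_ofReal (ae_of_all _ fun x => ENNReal.ofReal_lt_top) _).trans ?_
        simp [ENNReal.toReal_ofReal]
      have h2 : |T.toFun f π.1| ≤ ∫ x, |(f : X → ℝ) x| ∂(S π) := by
        rw [hg π f, h1]
        refine (abs_integral_le_integral_abs).trans (le_of_eq ?_)
        refine integral_congr_ae (ae_of_all _ fun x => ?_)
        simp only [abs_mul, mul_comm]
      refine h2.trans ?_
      exact integral_mono_measure (le_iSup S π) (ae_of_all _ fun x => abs_nonneg _)
        ((memLp_lipB f _ 1).integrable le_rfl).abs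
    refine le_of_forall_gt_imp_ge_of_dense fun b hb => ?_
    have hI : 0 ≤ ∫ x, |(f : X → ℝ) x| ∂(⨆ π, S π) := integral_nonneg fun x => abs_nonneg _
    obtain ⟨M, hKM, hM⟩ : ∃ M : ℝ≥0, K < M ∧ M * ∫ x, |(f : X → ℝ) x| ∂(⨆ π, S π) ≤ b := by
      generalize (∫ x, |(f : X → ℝ) x| ∂(⨆ π, S π)) = I at hb hI
      have h0 : 0 < b - K * I := by linarith
      have hq : 0 < (b - K * I) / (I + 1) := by positivity
      refine ⟨K + Real.toNNReal ((b - K * I) / (I + 1)),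
        lt_add_of_pos_right _ (Real.toNNReal_pos.2 hq), ?_⟩
      rw [NNReal.coe_add, Real.coe_toNNReal _ hq.le]
      have : (b - K * I) / (I + 1) * I ≤ b - K * I := by
        rw [div_mul_eq_mul_div, div_le_iff₀ (by linarith)]
        nlinarith
      linarith
    have hM0 : 0 < M := lt_of_le_of_lt K.2 hKM
    have hM0' : (0 : ℝ) < M := hM0
    have hl : LipschitzWith 1 (((M : ℝ)⁻¹ • π : Lip X) : X → ℝ) := by
      have := (lipschitzWith_smul ((M : ℝ)⁻¹)).comp hK
      refine this.weaken ?_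
      rw [← NNReal.coe_le_coe]
      simp only [NNReal.coe_mul, coe_nnnorm, norm_inv, Real.norm_eq_abs, NNReal.abs_eq,
        NNReal.coe_one]
      rw [inv_mul_le_one₀ hM0']
      exact_mod_cast hKM.le
    have h3 := hS ⟨_, hl⟩
    rw [map_smul, smul_eq_mul, abs_mul, abs_of_pos (inv_pos.2 hM0'), inv_mul_le_iff₀ hM0'] at h3
    exact h3.trans hM
  rwa [Current₁.massMeasure, hleast.isGLB.sInf_eq]

/-- `E` is `1`-rectifiable: it is a Lipschitz image of a bounded subset of `ℝ`. -/
def IsRectifiableSet (E : Set X) : Prop :=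
  ∃ (B : Set ℝ) (γ : B → X) (K : ℝ≥0),
    Bornology.IsBounded B ∧ LipschitzWith K γ ∧ Set.range γ = E

/-- `T` is a rectifiable `1`-current: `‖T‖` is concentrated on a countable union of `1`-rectifiable
sets and is absolutely continuous with respect to the one-dimensional Hausdorff measure. -/
def Current₁.IsRectifiable (T : Current₁ X) : Prop :=
  (∃ E : ℕ → Set X, (∀ i, IsRectifiableSet (E i)) ∧ T.massMeasure (⋃ i, E i)ᶜ = 0) ∧
    T.massMeasure ≪ Measure.hausdorffMeasure 1

/-- The metric speed `|θ'|(t) = limsup_{h → 0+} d(θ(t+h), θ(t)) / h`. -/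
def speed {X : Type*} [MetricSpace X] (θ : ℝ → X) (t : ℝ) : ℝ≥0∞ :=
  limsup (fun h : ℝ => edist (θ (t + h)) (θ t) / ENNReal.ofReal h) (𝓝[>] 0)

/-- The length `∫₀¹ |θ'|(t) dt` of a curve `θ` on `[0,1]`. (Values of `θ` off `[0,1]` do not
matter: `speed θ t` ignores them for `t < 1`.) -/
def length {X : Type*} [MetricSpace X] (θ : ℝ → X) : ℝ≥0∞ :=
  ∫⁻ t in Set.Icc (0 : ℝ) 1, speed θ t

/-- `X` is piecewise quasiconvex with constant `c ≥ 1`. -/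
def IsPiecewiseQuasiconvex (X : Type*) [MetricSpace X] (c : ℝ) : Prop :=
  1 ≤ c ∧ ∀ (x y : X) (ε : ℝ), 0 < ε → ∃ (m : ℕ) (p q : Fin (m + 1) → X),
    dist x (p 0) + dist (q (Fin.last m)) y + ∑ i : Fin m, dist (p i.succ) (q i.castSucc) < ε ∧
    ∃ θ : Fin (m + 1) → ℝ → X,
      (∀ i, (∃ K : ℝ≥0, LipschitzOnWith K (θ i) (Set.Icc 0 1)) ∧ θ i 0 = p i ∧ θ i 1 = q i) ∧
      ∑ i, length (θ i) ≤ ENNReal.ofReal (c * dist x y)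

end MetricCurrents

end

/-! Put `M = ‖∂T‖_KR`. The boundary is a linear functional on `Lip X`, bounded by `M` times the
Lipschitz constant and continuous along pointwise convergent, uniformly Lipschitz sequences; nothing
else about `T` is used. Such a functional `φ` is written as a series of weighted boundaries of
curves.

Duality with curves: if every weighted curve of mass at most `c * M` failed to nearly attain `φ f`,
then `f` would grow along all curves at rate at most `s = (φ f - ε) / (c * M)`. Piecewise
quasiconvexity makes `f` `c * s`-Lipschitz, so `φ f ≤ M * c * s = φ f - ε`, a contradiction
(`exists_curve_sub_lt`).

The curve depends on `f`. The `1`-Lipschitz functions vanishing at a base point form a compact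
convex set for pointwise convergence, so Sion's minimax theorem yields one convex combination of
curves that works for all `f` (`exists_finite_curves`). The remainder is a functional of the same
kind with arbitrarily small norm. Iterating with geometrically decreasing norms costs total mass `c
* (1 + δ) * M` (`exists_countable_curves`).

The series defines a current concentrated on countably many curves. Its mass ignores `ℋ¹`-null sets,
because a real Lipschitz function along a curve has zero derivative almost everywhere over such a
set (`LipCurve.abs_form_le`). -/

noncomputable section

namespace MetricCurrents

/-! ### Metric speed and derivatives of real functions along curves. -/

theorem measurable_speed {X : Type*} [MetricSpace X] {θ : ℝ → X} (hθ : Continuous θ) :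
    Measurable (speed θ) := by
  have hb : (𝓝[>] (0 : ℝ)).HasBasis (fun _ : ℕ => True)
      (fun n => Set.Ioo (0 : ℝ) (1 / ((n : ℝ) + 1))) := by
    refine (nhdsGT_basis (0 : ℝ)).to_hasBasis (fun r hr => ?_) fun n _ =>
      ⟨_, Nat.one_div_pos_of_nat, subset_rfl⟩
    obtain ⟨n, hn⟩ := exists_nat_one_div_lt hr
    exact ⟨n, trivial, Set.Ioo_subset_Ioo_right hn.le⟩
  have e : speed θ = fun t => ⨅ n : ℕ, ⨆ h ∈ Set.Ioo (0 : ℝ) (1 / ((n : ℝ) + 1)),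
      edist (θ (t + h)) (θ t) / ENNReal.ofReal h := by
    ext t
    rw [speed, hb.limsup_eq_iInf_iSup]
    simp
  rw [e]
  refine Measurable.iInf fun n => LowerSemicontinuous.measurable ?_
  -- The supremum runs over uncountably many `h`; each quotient is continuous in `t`, so the
  -- supremum is lower semicontinuous, hence measurable.
  refine lowerSemicontinuous_biSup fun h hh => Continuous.lowerSemicontinuous ?_
  refine ENNReal.continuous_div_const _ ?_ |>.comp ?_
  · simpa using hh.1
  · exact (hθ.comp (by fun_prop)).edist hθ

theorem speed_le_of_lipschitzWith {X : Type*} [MetricSpace X] {θ : ℝ → X} {K : ℝ≥0}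
    (hθ : LipschitzWith K θ) (t : ℝ) : speed θ t ≤ K := by
  refine limsup_le_of_le (h := ?_)
  filter_upwards [self_mem_nhdsWithin] with h (hh : 0 < h)
  refine ENNReal.div_le_of_le_mul ((hθ _ _).trans (le_of_eq ?_))
  rw [edist_dist, Real.dist_eq, add_sub_cancel_left, abs_of_pos hh]

theorem enorm_deriv_comp_le_speed {X : Type*} [MetricSpace X] {θ : ℝ → X} {π : X → ℝ} {K : ℝ≥0}
    (hπ : LipschitzWith K π) (t : ℝ) : ‖deriv (π ∘ θ) t‖ₑ ≤ K * speed θ t := by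
  by_cases hd : DifferentiableAt ℝ (π ∘ θ) t
  swap
  · simp [deriv_zero_of_not_differentiableAt hd]
  have h1 := hd.hasDerivAt.tendsto_slope_zero_right
  have h2 := (continuous_enorm.tendsto _).comp h1
  rw [speed, ← ENNReal.limsup_const_mul_of_ne_top ENNReal.coe_ne_top, ← h2.limsup_eq]
  refine limsup_le_limsup ?_
  filter_upwards [self_mem_nhdsWithin] with h (hh : 0 < h)
  simp only [Function.comp_apply, enorm_smul]
  rw [← edist_eq_enorm_sub, enorm_inv hh.ne', mul_comm, ← div_eq_mul_inv, mul_div_assoc',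
    Real.enorm_of_nonneg hh.le]
  exact ENNReal.div_le_div_right (hπ _ _) _

/-- A function has zero derivative almost everywhere on a set whose image is Lebesgue null. -/
theorem ae_deriv_eq_zero_of_volume_image_eq_zero (g : ℝ → ℝ) (s : Set ℝ)
    (hs : volume (g '' s) = 0) : ∀ᵐ t, t ∈ s → deriv g t = 0 := by
  -- Where the derivative is nonzero, `g` expands distances to nearby points on the right. Sorting
  -- such points by an expansion scale `n` and by cells of length `1 / (n + 1)` gives countably many
  -- sets on which `g` is antilipschitz, and these are null because their images are.
  let A : ℕ → ℤ → Set ℝ := fun n k => {t | t ∈ s ∧ (k : ℝ) ≤ (n + 1) * t ∧ (n + 1) * t < k + 1 ∧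
    ∀ u, t < u → u < t + 1 / (n + 1 : ℝ) → u - t ≤ (n + 1) * |g u - g t|}
  have hA : ∀ n k, volume (A n k) = 0 := by
    intro n k
    have key : ∀ t ∈ A n k, ∀ u ∈ A n k, t < u → u - t ≤ (n + 1) * |g u - g t| := by
      intro t ht u hu htu
      refine ht.2.2.2 u htu ?_
      have hn : (0 : ℝ) < n + 1 := by positivity
      have : (n + 1) * (u - t) < 1 := by linarith [ht.2.1, hu.2.2.1]
      have : u - t < 1 / (n + 1) := by rwa [lt_div_iff₀' hn]
      linarith
    have anti : AntilipschitzWith (n + 1 : ℝ≥0) (fun t : A n k => g t) := by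
      refine AntilipschitzWith.of_le_mul_dist fun t u => ?_
      rw [Subtype.dist_eq, Real.dist_eq, Real.dist_eq]
      push_cast
      rcases lt_trichotomy (t : ℝ) u with h | h | h
      · rw [abs_sub_comm, abs_of_pos (sub_pos.2 h), abs_sub_comm (g t)]
        exact key _ t.2 _ u.2 h
      · simp [h]
      · rw [abs_of_pos (sub_pos.2 h)]
        exact key _ u.2 _ t.2 h
    have h1 := anti.le_hausdorffMeasure_image zero_le_one Set.univ
    have h2 : (fun t : A n k => g t) '' Set.univ ⊆ g '' s := by
      rintro _ ⟨t, -, rfl⟩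
      exact ⟨t, t.2.1, rfl⟩
    have h3 := (isometry_subtype_coe (s := A n k)).hausdorffMeasure_image (d := 1)
      (Or.inl zero_le_one) Set.univ
    rw [Set.image_univ, Subtype.range_coe, hausdorffMeasure_real] at h3
    rw [hausdorffMeasure_real, measure_mono_null h2 hs, mul_zero] at h1
    rw [h3]
    exact le_antisymm h1 zero_le
  have hU : volume (⋃ n, ⋃ k, A n k) = 0 :=
    measure_iUnion_null fun n => measure_iUnion_null fun k => hA n k
  filter_upwards [measure_eq_zero_iff_ae_notMem.1 hU] with t ht hts
  by_contra hd
  apply ht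
  have hdiff : DifferentiableAt ℝ g t := by
    by_contra h
    exact hd (deriv_zero_of_not_differentiableAt h)
  have h1 := hdiff.hasDerivAt.tendsto_slope_zero_right.abs
  have hpos : 0 < |deriv g t| := abs_pos.2 hd
  have h2 := h1.eventually (lt_mem_nhds (half_lt_self hpos))
  obtain ⟨r, hr : 0 < r, h3⟩ := (nhdsGT_basis (0 : ℝ)).eventually_iff.1 h2
  obtain ⟨n, hn⟩ := exists_nat_one_div_lt (lt_min hr (half_pos hpos))
  rw [Set.mem_iUnion]
  refine ⟨n, Set.mem_iUnion.2 ⟨⌊(n + 1) * t⌋, hts, Int.floor_le _, Int.lt_floor_add_one _, ?_⟩⟩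
  intro u htu hu
  have hn' : (0 : ℝ) < n + 1 := by positivity
  have h4 := h3 (x := u - t) ⟨by linarith, by linarith [hn.trans_le (min_le_left _ _)]⟩
  rw [add_sub_cancel, smul_eq_mul, abs_mul, abs_inv, abs_of_pos (sub_pos.2 htu)] at h4
  have h5 := (hn.trans_le (min_le_right _ _)).trans h4
  rw [inv_mul_eq_div, lt_div_iff₀ (sub_pos.2 htu), div_mul_eq_mul_div, one_mul,
    div_lt_iff₀ hn'] at h5
  linarith

/-! ### The current carried by a single Lipschitz curve. -/

/-- Globally Lipschitz curves, of which only the restriction to `[0,1]` matters. -/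
abbrev LipCurve (X : Type*) [MetricSpace X] : Type _ := {θ : ℝ → X // ∃ K : ℝ≥0, LipschitzWith K θ}

namespace LipCurve

section
variable {X : Type*} [MetricSpace X]

theorem continuous (θ : LipCurve X) : Continuous θ.1 := θ.2.choose_spec.continuous

theorem length_ne_top (θ : LipCurve X) : length θ.1 ≠ ∞ := by
  obtain ⟨K, hK⟩ := θ.2
  refine ne_top_of_le_ne_top (b := K * volume (Set.Icc (0 : ℝ) 1)) ?_ ?_
  · simp
  · refine (lintegral_mono (g := fun _ => (K : ℝ≥0∞))
      fun t => speed_le_of_lipschitzWith hK t).trans ?_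
    simp

/-- The length of a curve as a nonnegative real number. -/
def len (θ : LipCurve X) : ℝ≥0 := (length θ.1).toNNReal

theorem coe_len (θ : LipCurve X) : (θ.len : ℝ≥0∞) = length θ.1 :=
  ENNReal.coe_toNNReal θ.length_ne_top

theorem exists_lipschitzWith_comp (θ : LipCurve X) (f : Lip X) :
    ∃ K : ℝ≥0, LipschitzWith K ((f : X → ℝ) ∘ θ.1) := by
  obtain ⟨K, hK⟩ := θ.2
  obtain ⟨L, hL⟩ := f.2
  exact ⟨_, hL.comp hK⟩

theorem ae_differentiableAt_comp (θ : LipCurve X) (f : Lip X) :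
    ∀ᵐ t, DifferentiableAt ℝ ((f : X → ℝ) ∘ θ.1) t := by
  obtain ⟨K, hK⟩ := θ.exists_lipschitzWith_comp f
  exact hK.ae_differentiableAt_real

theorem absolutelyContinuous_comp (θ : LipCurve X) (f : Lip X) :
    AbsolutelyContinuousOnInterval ((f : X → ℝ) ∘ θ.1) 0 1 := by
  obtain ⟨K, hK⟩ := θ.exists_lipschitzWith_comp f
  exact hK.lipschitzOnWith.absolutelyContinuousOnInterval

theorem intervalIntegrable_mul_deriv (θ : LipCurve X) (f : LipB X) (π : Lip X) :
    IntervalIntegrable (fun t => (f : X → ℝ) (θ.1 t) * deriv ((π : X → ℝ) ∘ θ.1) t)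
      volume 0 1 :=
  (θ.absolutelyContinuous_comp π).intervalIntegrable_deriv.continuousOn_mul
    ((continuous_lipB f).comp θ.continuous).continuousOn

theorem isRectifiableSet_image (θ : LipCurve X) : IsRectifiableSet (θ.1 '' Set.Icc 0 1) := by
  obtain ⟨K, hK⟩ := θ.2
  refine ⟨Set.Icc 0 1, (Set.Icc 0 1).domRestrict θ.1, K, Metric.isBounded_Icc 0 1,
    fun s t => hK s t, Set.range_domRestrict _ _⟩

/-- The bilinear form `(f, π) ↦ ∫₀¹ f(θ(t)) (π ∘ θ)'(t) dt`. -/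
def form (θ : LipCurve X) : LipB X →ₗ[ℝ] Lip X →ₗ[ℝ] ℝ :=
  LinearMap.mk₂ ℝ (fun f π => ∫ t in (0 : ℝ)..1, (f : X → ℝ) (θ.1 t) *
      deriv ((π : X → ℝ) ∘ θ.1) t)
    (fun f g π => by
      rw [← intervalIntegral.integral_add (θ.intervalIntegrable_mul_deriv f π)
        (θ.intervalIntegrable_mul_deriv g π)]
      simp [add_mul])
    (fun a f π => by
      rw [smul_eq_mul, ← intervalIntegral.integral_const_mul]
      simp [mul_assoc])
    (fun f π σ => by
      rw [← intervalIntegral.integral_add (θ.intervalIntegrable_mul_deriv f π)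
        (θ.intervalIntegrable_mul_deriv f σ)]
      refine intervalIntegral.integral_congr_ae ?_
      filter_upwards [θ.ae_differentiableAt_comp π, θ.ae_differentiableAt_comp σ] with t h1 h2 _
      rw [← mul_add, ← deriv_add h1 h2]
      rfl)
    (fun a f π => by
      rw [smul_eq_mul, ← intervalIntegral.integral_const_mul]
      refine intervalIntegral.integral_congr fun t _ => ?_
      have : deriv (((a • π : Lip X) : X → ℝ) ∘ θ.1) t = a * deriv ((π : X → ℝ) ∘ θ.1) t :=
        deriv_const_mul_field (v := (π : X → ℝ) ∘ θ.1) a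
      simp only [this]
      ring)

theorem form_apply (θ : LipCurve X) (f : LipB X) (π : Lip X) :
    θ.form f π = ∫ t in (0 : ℝ)..1, (f : X → ℝ) (θ.1 t) * deriv ((π : X → ℝ) ∘ θ.1) t := rfl

/-- Integration by parts moves the derivative from `π` to `f`. Continuity in `π` needs this, since
pointwise convergence does not control derivatives. -/
theorem form_eq_sub (θ : LipCurve X) (f : LipB X) (π : Lip X) :
    θ.form f π = (f : X → ℝ) (θ.1 1) * (π : X → ℝ) (θ.1 1) -
      (f : X → ℝ) (θ.1 0) * (π : X → ℝ) (θ.1 0) -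
      ∫ t in (0 : ℝ)..1, deriv ((f : X → ℝ) ∘ θ.1) t * (π : X → ℝ) (θ.1 t) :=
  (θ.absolutelyContinuous_comp ⟨f, f.2.1⟩).integral_mul_deriv_eq_deriv_mul
    (θ.absolutelyContinuous_comp π)

theorem form_one (θ : LipCurve X) (π : Lip X) :
    θ.form (oneB X) π = (π : X → ℝ) (θ.1 1) - (π : X → ℝ) (θ.1 0) := by
  rw [form_apply]
  simpa [oneB] using (θ.absolutelyContinuous_comp π).integral_deriv_eq_sub

theorem tendsto_form (θ : LipCurve X) (f : LipB X) (π : Lip X) (πs : ℕ → Lip X) (C : ℝ≥0)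
    (hC : ∀ j, LipschitzWith C (πs j : X → ℝ))
    (hlim : ∀ x, Tendsto (fun j => (πs j : X → ℝ) x) atTop (𝓝 ((π : X → ℝ) x))) :
    Tendsto (fun j => θ.form f (πs j)) atTop (𝓝 (θ.form f π)) := by
  obtain ⟨K, hK⟩ := θ.2
  -- Convergence bounds `πs j` at the initial point, and the common Lipschitz constant carries the
  -- bound along the curve; this gives the dominating function.
  obtain ⟨B, hB⟩ := (hlim (θ.1 0)).abs.bddAbove_range
  have hbd : ∀ j, ∀ t ∈ Set.Ioc (0 : ℝ) 1, |(πs j : X → ℝ) (θ.1 t)| ≤ B + C * K := by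
    intro j t ht
    have h1 : |(πs j : X → ℝ) (θ.1 0)| ≤ B := hB ⟨j, rfl⟩
    have h2 := ((hC j).comp hK).dist_le_mul t 0
    rw [Real.dist_eq, Real.dist_eq, sub_zero, abs_of_pos ht.1] at h2
    have h3 : ((C * K : ℝ≥0) : ℝ) * t ≤ C * K := by
      rw [NNReal.coe_mul]
      exact mul_le_of_le_one_right (by positivity) ht.2
    have h4 := abs_sub_abs_le_abs_sub ((πs j : X → ℝ) (θ.1 t)) ((πs j : X → ℝ) (θ.1 0))
    simp only [Function.comp_apply] at h2
    linarith
  have hfi := (θ.absolutelyContinuous_comp ⟨f, f.2.1⟩).intervalIntegrable_deriv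
  simp only [form_eq_sub]
  refine (((hlim _).const_mul _).sub ((hlim _).const_mul _)).sub ?_
  refine intervalIntegral.tendsto_integral_filter_of_dominated_convergence
    (fun t => |deriv ((f : X → ℝ) ∘ θ.1) t| * (B + C * K)) (.of_forall fun j => ?_)
    (.of_forall fun j => ae_of_all _ fun t ht => ?_) (hfi.abs.mul_const _)
    (ae_of_all _ fun t _ => (hlim _).const_mul _)
  · exact (intervalIntegrable_iff.1 (hfi.mul_continuousOn
      ((hC j).continuous.comp hK.continuous).continuousOn)).aestronglyMeasurable
  · rw [Set.uIoc_of_le zero_le_one] at ht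
    rw [norm_mul]
    exact mul_le_mul_of_nonneg_left (hbd j t ht) (abs_nonneg _)

/-- If `π` is constant near the support of `f`, the form vanishes. -/
theorem form_eq_zero (θ : LipCurve X) (f : LipB X) (π : Lip X) (U : Set X) (a : ℝ)
    (hU : IsOpen U) (hf : tsupport (f : X → ℝ) ⊆ U) (hπ : ∀ x ∈ U, (π : X → ℝ) x = a) :
    θ.form f π = 0 := by
  rw [form_apply]
  refine (intervalIntegral.integral_congr fun t _ => ?_).trans intervalIntegral.integral_zero
  by_cases ht : θ.1 t ∈ U
  · have : (π : X → ℝ) ∘ θ.1 =ᶠ[𝓝 t] fun _ => a := by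
      filter_upwards [(hU.preimage θ.continuous).mem_nhds ht] with s hs
      exact hπ _ hs
    simp [this.deriv_eq]
  · have : (f : X → ℝ) (θ.1 t) = 0 := image_eq_zero_of_notMem_tsupport fun h => ht (hf h)
    simp [this]

end

variable {X : Type*} [MetricSpace X] [MeasurableSpace X] [BorelSpace X]

/-- The image of the arc length measure under the curve. -/
def measure (θ : LipCurve X) : Measure X :=
  ((volume.restrict (Set.Icc (0 : ℝ) 1)).withDensity (speed θ.1)).map θ.1

theorem measure_univ (θ : LipCurve X) : θ.measure Set.univ = θ.len := by
  rw [measure, Measure.map_apply θ.continuous.measurable MeasurableSet.univ, Set.preimage_univ,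
    withDensity_apply _ MeasurableSet.univ, Measure.restrict_univ, coe_len, length]

instance (θ : LipCurve X) : IsFiniteMeasure θ.measure :=
  ⟨by rw [measure_univ]; exact ENNReal.coe_lt_top⟩

theorem measure_compl_image (θ : LipCurve X) : θ.measure (θ.1 '' Set.Icc 0 1)ᶜ = 0 := by
  have hm : MeasurableSet (θ.1 '' Set.Icc 0 1) :=
    (isCompact_Icc.image θ.continuous).isClosed.measurableSet
  rw [measure, Measure.map_apply θ.continuous.measurable hm.compl]
  refine withDensity_absolutelyContinuous _ _ ?_
  rw [Measure.restrict_apply (θ.continuous.measurable hm.compl)]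
  convert! measure_empty (μ := volume)
  ext t
  simp only [Set.mem_inter_iff, Set.mem_preimage, Set.mem_compl_iff, Set.mem_empty_iff_false,
    iff_false, not_and]
  exact fun h1 h2 => h1 ⟨t, h2, rfl⟩

/-- The form is bounded by the arc length measure, from which `ℋ¹`-null sets can be removed. -/
theorem abs_form_le (θ : LipCurve X) (f : LipB X) (π : Lip X) (K : ℝ≥0)
    (hK : LipschitzWith K (π : X → ℝ)) (N : Set X) (hN : MeasurableSet N)
    (hN0 : Measure.hausdorffMeasure 1 N = 0) :
    |θ.form f π| ≤ K * ∫ x, |(f : X → ℝ) x| ∂(θ.measure.restrict Nᶜ) := by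
  have hθ := θ.continuous
  have hsm := measurable_speed hθ
  obtain ⟨L, hL⟩ := θ.2
  obtain ⟨-, B, hB⟩ := f.2
  have hsp : ∀ t, speed θ.1 t < ∞ := fun t =>
    (speed_le_of_lipschitzWith hL t).trans_lt ENNReal.coe_lt_top
  have hAm : MeasurableSet (θ.1 ⁻¹' Nᶜ) := hθ.measurable hN.compl
  have h1 : ∫ x, |(f : X → ℝ) x| ∂(θ.measure.restrict Nᶜ) =
      ∫ t in θ.1 ⁻¹' Nᶜ, (speed θ.1 t).toReal * |(f : X → ℝ) (θ.1 t)|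
        ∂(volume.restrict (Set.Icc (0 : ℝ) 1)) := by
    rw [measure, Measure.restrict_map hθ.measurable hN.compl, restrict_withDensity hAm,
      integral_map hθ.aemeasurable (continuous_lipB f).abs.aestronglyMeasurable,
      integral_withDensity_eq_integral_toReal_smul hsm (ae_of_all _ hsp)]
    rfl
  have h2 : ∀ᵐ t ∂(volume.restrict (Set.Icc (0 : ℝ) 1)), t ∉ θ.1 ⁻¹' Nᶜ →
      |(f : X → ℝ) (θ.1 t) * deriv ((π : X → ℝ) ∘ θ.1) t| = 0 := by
    refine ae_restrict_of_ae ?_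
    -- A Lipschitz real function sends the `ℋ¹`-null set `N` to a Lebesgue null set, so the
    -- derivative of `π ∘ θ` vanishes at almost every time spent in `N`.
    have h3 : volume (((π : X → ℝ) ∘ θ.1) '' (θ.1 ⁻¹' N)) = 0 := by
      refine measure_mono_null (t := (π : X → ℝ) '' N) ?_ ?_
      · rintro _ ⟨t, ht, rfl⟩
        exact ⟨_, ht, rfl⟩
      · have := hK.hausdorffMeasure_image_le zero_le_one N
        rw [hN0, mul_zero, hausdorffMeasure_real] at this
        exact le_antisymm this zero_le
    filter_upwards [ae_deriv_eq_zero_of_volume_image_eq_zero _ _ h3] with t ht htN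
    rw [ht (not_not.1 htN), mul_zero, abs_zero]
  rw [form_apply, intervalIntegral.integral_of_le zero_le_one, ← integral_Icc_eq_integral_Ioc, h1,
    ← integral_const_mul]
  refine abs_integral_le_integral_abs.trans ?_
  rw [← setIntegral_eq_integral_of_ae_compl_eq_zero h2]
  refine integral_mono_of_nonneg (ae_of_all _ fun t => abs_nonneg _) ?_ (ae_of_all _ fun t => ?_)
  · refine (Integrable.of_bound (C := L * B) ?_ (ae_of_all _ fun t => ?_)).const_mul _
    · exact (hsm.ennreal_toReal.mul
        ((continuous_lipB f).comp hθ).abs.measurable).aestronglyMeasurable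
    · rw [Real.norm_eq_abs, abs_mul, abs_abs, abs_of_nonneg ENNReal.toReal_nonneg]
      refine mul_le_mul ?_ (hB _) (abs_nonneg _) L.2
      exact ENNReal.toReal_le_of_le_ofReal L.2
        (by simpa using speed_le_of_lipschitzWith hL t)
  · simp only
    rw [abs_mul, mul_comm, ← mul_assoc]
    refine mul_le_mul_of_nonneg_right ?_ (abs_nonneg _)
    have h3 := ENNReal.toReal_mono (ENNReal.mul_ne_top ENNReal.coe_ne_top (hsp t).ne)
      (enorm_deriv_comp_le_speed (θ := θ.1) hK t)
    simpa using h3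

theorem abs_form_le_len (θ : LipCurve X) (f : LipB X) (π : Lip X) (K : ℝ≥0)
    (hK : LipschitzWith K (π : X → ℝ)) (B : ℝ) (hB : ∀ x, |(f : X → ℝ) x| ≤ B) :
    |θ.form f π| ≤ K * (B * θ.len) := by
  have h := θ.abs_form_le f π K hK ∅ MeasurableSet.empty measure_empty
  rw [Set.compl_empty, Measure.restrict_univ] at h
  refine h.trans (mul_le_mul_of_nonneg_left ?_ K.2)
  have := norm_integral_le_of_norm_le_const (μ := θ.measure) (f := fun x => |(f : X → ℝ) x|)
    (C := B) (ae_of_all _ fun x => by simpa using hB x)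
  refine (le_abs_self _).trans (this.trans (le_of_eq ?_))
  simp [Measure.real, measure_univ]

theorem abs_sub_le_len (θ : LipCurve X) (f : Lip X) (K : ℝ≥0)
    (hK : LipschitzWith K (f : X → ℝ)) :
    |(f : X → ℝ) (θ.1 1) - (f : X → ℝ) (θ.1 0)| ≤ K * θ.len := by
  rw [← form_one]
  simpa using θ.abs_form_le_len (oneB X) f K hK 1 (fun x => by simp [oneB])

end LipCurve

/-! ### Weighted sums of curves and their rectifiability. -/

section WeightedSum

variable {X : Type*} [MetricSpace X] [MeasurableSpace X] [BorelSpace X]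
variable {ι : Type*} (a : ι → ℝ≥0) (θ : ι → LipCurve X)

theorem summable_mul_form (h : Summable fun i => a i * (θ i).len) (f : LipB X) (π : Lip X) :
    Summable fun i => (a i : ℝ) * (θ i).form f π := by
  obtain ⟨K, hK⟩ := π.2
  obtain ⟨-, B, hB⟩ := f.2
  refine Summable.of_norm_bounded (g := fun i => ((a i * (θ i).len : ℝ≥0) : ℝ) * (K * B))
    ((NNReal.summable_coe.2 h).mul_right _) fun i => ?_
  rw [norm_mul, Real.norm_eq_abs, Real.norm_eq_abs, NNReal.abs_eq]
  refine (mul_le_mul_of_nonneg_left ((θ i).abs_form_le_len f π K hK B hB) (a i).coe_nonneg).trans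
    (le_of_eq ?_)
  push_cast
  ring

/-- The bilinear form `∑ aᵢ [θᵢ]`. -/
def sumForm (h : Summable fun i => a i * (θ i).len) : LipB X →ₗ[ℝ] Lip X →ₗ[ℝ] ℝ :=
  LinearMap.mk₂ ℝ (fun f π => ∑' i, (a i : ℝ) * (θ i).form f π)
    (fun f g π => by
      rw [← (summable_mul_form a θ h f π).tsum_add (summable_mul_form a θ h g π)]
      simp [mul_add])
    (fun r f π => by
      rw [smul_eq_mul, ← tsum_mul_left]
      simp [mul_left_comm])
    (fun f π σ => by
      rw [← (summable_mul_form a θ h f π).tsum_add (summable_mul_form a θ h f σ)]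
      simp [mul_add])
    (fun r f π => by
      rw [smul_eq_mul, ← tsum_mul_left]
      simp [mul_left_comm])

theorem sumForm_apply (h : Summable fun i => a i * (θ i).len) (f : LipB X) (π : Lip X) :
    sumForm a θ h f π = ∑' i, (a i : ℝ) * (θ i).form f π := rfl

/-- The measure `∑ aᵢ ‖[θᵢ]‖` outside the set `N`. -/
def sumMeasure (N : Set X) : Measure X :=
  Measure.sum fun i => (a i : ℝ≥0∞) • (θ i).measure.restrict Nᶜ

theorem sumMeasure_univ_le (h : Summable fun i => a i * (θ i).len) (N : Set X) :
    sumMeasure a θ N Set.univ ≤ (∑' i, a i * (θ i).len : ℝ≥0) := by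
  rw [sumMeasure, Measure.sum_apply _ MeasurableSet.univ, ENNReal.coe_tsum h]
  refine ENNReal.tsum_le_tsum fun i => ?_
  rw [Measure.smul_apply, smul_eq_mul, ENNReal.coe_mul, ← LipCurve.measure_univ]
  gcongr
  exact Measure.restrict_le_self

/-- The freedom in `N` is the point: `N = ∅` gives finite mass, while removing a given null set and
using minimality of the mass measure gives absolute continuity. -/
theorem sumMeasure_mem_massBounds (h : Summable fun i => a i * (θ i).len) (N : Set X)
    (hN : MeasurableSet N) (hN0 : Measure.hausdorffMeasure 1 N = 0) :
    sumMeasure a θ N ∈ massBounds (sumForm a θ h) := by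
  have hfin : IsFiniteMeasure (sumMeasure a θ N) :=
    ⟨(sumMeasure_univ_le a θ h N).trans_lt ENNReal.coe_lt_top⟩
  refine ⟨hfin, fun f π K hK => ?_⟩
  have hi : Integrable (fun x => |(f : X → ℝ) x|) (sumMeasure a θ N) :=
    ((memLp_lipB f _ 1).integrable le_rfl).abs
  have hs := (hasSum_integral_measure hi).mul_left (K : ℝ)
  rw [sumForm_apply]
  rw [← Real.norm_eq_abs]
  refine tsum_of_norm_bounded hs fun i => ?_
  rw [norm_mul, Real.norm_eq_abs, Real.norm_eq_abs, NNReal.abs_eq, integral_smul_measure,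
    ENNReal.coe_toReal, smul_eq_mul, mul_left_comm]
  exact mul_le_mul_of_nonneg_left ((θ i).abs_form_le f π K hK N hN hN0) (a i).coe_nonneg

/-- The current `∑ aᵢ [θᵢ]`. -/
def sumCurrent (h : Summable fun i => a i * (θ i).len) : Current₁ X where
  toFun := sumForm a θ h
  finite_mass := ⟨_, sumMeasure_mem_massBounds a θ h ∅ MeasurableSet.empty measure_empty⟩
  continuity f π πs C hC hlim := by
    obtain ⟨-, B, hB⟩ := f.2
    refine tendsto_tsum_of_dominated_convergence
      (bound := fun i => ((a i * (θ i).len : ℝ≥0) : ℝ) * (C * B))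
      ((NNReal.summable_coe.2 h).mul_right _)
      (fun i => ((θ i).tendsto_form f π πs C hC hlim).const_mul _) (.of_forall fun j i => ?_)
    rw [norm_mul, Real.norm_eq_abs, Real.norm_eq_abs, NNReal.abs_eq]
    refine (mul_le_mul_of_nonneg_left ((θ i).abs_form_le_len f (πs j) C (hC j) B hB)
      (a i).coe_nonneg).trans (le_of_eq ?_)
    push_cast
    ring
  locality f π U r hU hf hπ := by
    rw [sumForm_apply]
    simp [fun i => (θ i).form_eq_zero f π U r hU hf hπ]

theorem massMeasure_sumCurrent_le (h : Summable fun i => a i * (θ i).len) (N : Set X)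
    (hN : MeasurableSet N) (hN0 : Measure.hausdorffMeasure 1 N = 0) :
    (sumCurrent a θ h).massMeasure ≤ sumMeasure a θ N :=
  (sumCurrent a θ h).isLeast_massMeasure.2 (sumMeasure_mem_massBounds a θ h N hN hN0)

theorem mass_sumCurrent_le (h : Summable fun i => a i * (θ i).len) :
    (sumCurrent a θ h).mass ≤ (∑' i, a i * (θ i).len : ℝ≥0) :=
  (massMeasure_sumCurrent_le a θ h ∅ MeasurableSet.empty measure_empty _).trans
    (sumMeasure_univ_le a θ h ∅)

theorem boundary_sumCurrent (h : Summable fun i => a i * (θ i).len) (f : Lip X) :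
    (sumCurrent a θ h).boundary f =
      ∑' i, (a i : ℝ) * ((f : X → ℝ) ((θ i).1 1) - (f : X → ℝ) ((θ i).1 0)) := by
  change sumForm a θ h (oneB X) f = _
  simp only [sumForm_apply, LipCurve.form_one]

theorem isRectifiable_sumCurrent [Countable ι] (h : Summable fun i => a i * (θ i).len) :
    (sumCurrent a θ h).IsRectifiable := by
  refine ⟨?_, fun N hN => ?_⟩
  · have hempty : IsRectifiableSet (∅ : Set X) :=
      ⟨∅, fun t => t.2.elim, 0, Bornology.isBounded_empty, fun t => t.2.elim, by simp⟩
    obtain ⟨e, he⟩ : ∃ E : ℕ → Set X, (∀ n, IsRectifiableSet (E n)) ∧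
        ∀ i, ∃ n, (θ i).1 '' Set.Icc 0 1 = E n := by
      rcases isEmpty_or_nonempty ι with hι | hι
      · exact ⟨fun _ => ∅, fun _ => hempty, fun i => (IsEmpty.false i).elim⟩
      · obtain ⟨u, hu⟩ := exists_surjective_nat ι
        exact ⟨fun n => (θ (u n)).1 '' Set.Icc 0 1, fun n => (θ (u n)).isRectifiableSet_image,
          fun i => by
            obtain ⟨n, rfl⟩ := hu i
            exact ⟨n, rfl⟩⟩
    refine ⟨e, he.1, measure_mono_null (t := (⋃ i, (θ i).1 '' Set.Icc 0 1)ᶜ) ?_ ?_⟩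
    · refine Set.compl_subset_compl.2 (Set.iUnion_subset fun i => ?_)
      obtain ⟨n, hn⟩ := he.2 i
      exact hn ▸ Set.subset_iUnion e n
    have hle := massMeasure_sumCurrent_le a θ h ∅ MeasurableSet.empty measure_empty
    refine le_antisymm ((hle _).trans (le_of_eq ?_)) zero_le
    rw [sumMeasure, Measure.sum_apply_of_countable, ENNReal.tsum_eq_zero]
    intro i
    rw [Set.compl_empty, Measure.restrict_univ, Measure.smul_apply,
      measure_mono_null (Set.compl_subset_compl.2 (Set.subset_iUnion _ i))
        (θ i).measure_compl_image, smul_zero]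
  -- `N` need not be Borel, so its measurable hull, still `ℋ¹`-null, is removed instead.
  · have hN' : Measure.hausdorffMeasure 1 (toMeasurable (Measure.hausdorffMeasure 1) N) = 0 := by
      rw [measure_toMeasurable, hN]
    have hm := measurableSet_toMeasurable (Measure.hausdorffMeasure 1) N
    have hle := massMeasure_sumCurrent_le a θ h _ hm hN'
    refine measure_mono_null (subset_toMeasurable (Measure.hausdorffMeasure 1) N)
      (le_antisymm ((hle _).trans (le_of_eq ?_)) zero_le)
    rw [sumMeasure, Measure.sum_apply _ hm, ENNReal.tsum_eq_zero]
    intro i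
    rw [Measure.smul_apply, Measure.restrict_apply hm, Set.inter_compl_self, measure_empty,
      smul_zero]

end WeightedSum

/-! ### Compactness of Lipschitz functions, and Lipschitz bounds read off from curves. -/

section
variable {X : Type*} [MetricSpace X]

/-- The real-valued `1`-Lipschitz functions vanishing at `x₀`. -/
def pointedLip (x₀ : X) : Set (X → ℝ) := {f | LipschitzWith 1 f ∧ f x₀ = 0}

/-- Tychonoff: a closed subset of the product of the intervals `[-d(x, x₀), d(x, x₀)]`. -/
theorem isCompact_pointedLip (x₀ : X) : IsCompact (pointedLip x₀) := by
  refine (isCompact_univ_pi fun x =>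
    isCompact_Icc (a := -dist x x₀) (b := dist x x₀)).of_isClosed_subset ?_ fun f hf x _ => ?_
  · have e : pointedLip x₀ = (⋂ x, ⋂ y, {f : X → ℝ | dist (f x) (f y) ≤ dist x y}) ∩
        {f | f x₀ = 0} := by
      ext f
      simp [pointedLip, lipschitzWith_iff_dist_le_mul]
    rw [e]
    refine (isClosed_iInter fun x => isClosed_iInter fun y => isClosed_le ?_ continuous_const).inter
      (isClosed_eq (continuous_apply _) continuous_const)
    exact (continuous_apply x).dist (continuous_apply y)
  · have := hf.1.dist_le_mul x x₀
    rw [hf.2, Real.dist_eq, sub_zero, NNReal.coe_one, one_mul] at this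
    exact abs_le.1 this

theorem convex_pointedLip (x₀ : X) : Convex ℝ (pointedLip x₀) := by
  intro f hf g hg s t hs ht hst
  refine ⟨LipschitzWith.of_dist_le_mul fun x y => ?_, by simp [hf.2, hg.2]⟩
  have h1 := hf.1.dist_le_mul x y
  have h2 := hg.1.dist_le_mul x y
  rw [NNReal.coe_one, one_mul, Real.dist_eq] at *
  have e : (s • f + t • g) x - (s • f + t • g) y = s * (f x - f y) + t * (g x - g y) := by
    simp only [Pi.add_apply, Pi.smul_apply, smul_eq_mul]
    ring
  rw [e]
  refine (abs_add_le _ _).trans ?_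
  rw [abs_mul, abs_mul, abs_of_nonneg hs, abs_of_nonneg ht]
  calc _ ≤ s * dist x y + t * dist x y := by gcongr
    _ = dist x y := by rw [← add_mul, hst, one_mul]

/-- Evaluation on a dense sequence is a continuous injection of a compact space into `ℕ → ℝ`, hence
an embedding. Metrizability turns sequential continuity into continuity. -/
theorem metrizableSpace_pointedLip [TopologicalSpace.SeparableSpace X] (x₀ : X) :
    TopologicalSpace.MetrizableSpace (pointedLip x₀) := by
  have : Nonempty X := ⟨x₀⟩
  have : CompactSpace (pointedLip x₀) := isCompact_iff_compactSpace.1 (isCompact_pointedLip x₀)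
  let r : pointedLip x₀ → ℕ → ℝ := fun f n => f.1 (TopologicalSpace.denseSeq X n)
  have hr : Continuous r :=
    continuous_pi fun n => (continuous_apply _).comp continuous_subtype_val
  have hi : Function.Injective r := by
    intro f g hfg
    refine Subtype.ext (f.2.1.continuous.ext_on (TopologicalSpace.denseRange_denseSeq X)
      g.2.1.continuous ?_)
    rintro _ ⟨n, rfl⟩
    exact congrFun hfg n
  exact (hr.isClosedEmbedding hi).isEmbedding.metrizableSpace

/-- Continuity along pointwise convergent sequences with bounded Lipschitz constants. -/
def IsSeqContinuous (φ : Lip X →ₗ[ℝ] ℝ) : Prop :=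
  ∀ (f : Lip X) (fs : ℕ → Lip X) (C : ℝ≥0), (∀ j, LipschitzWith C (fs j : X → ℝ)) →
    (∀ x, Tendsto (fun j => (fs j : X → ℝ) x) atTop (𝓝 ((f : X → ℝ) x))) →
    Tendsto (fun j => φ (fs j)) atTop (𝓝 (φ f))

theorem IsSeqContinuous.continuousOn_pointedLip [TopologicalSpace.SeparableSpace X]
    {φ : Lip X →ₗ[ℝ] ℝ} (hφ : IsSeqContinuous φ) (ψ : (X → ℝ) →ₗ[ℝ] ℝ)
    (hψ : ∀ f : Lip X, ψ f = φ f) (x₀ : X) : ContinuousOn ψ (pointedLip x₀) := by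
  have := metrizableSpace_pointedLip x₀
  rw [continuousOn_iff_continuous_domRestrict]
  refine SeqContinuous.continuous fun fs f h => ?_
  have hl : ∀ f : pointedLip x₀, f.1 ∈ Lip X := fun f => ⟨1, f.2.1⟩
  have := hφ ⟨f.1, hl f⟩ (fun j => ⟨(fs j).1, hl _⟩) 1 (fun j => (fs j).2.1) fun x =>
    (((continuous_apply x).comp continuous_subtype_val).tendsto f).comp h
  simp only [← hψ] at this
  exact this

/-- Freezing the curve outside `[0,1]` keeps the speed on `[0,1)`, which only looks to the right;
the endpoint `1` is negligible. -/
theorem exists_lipCurve {θ : ℝ → X} {K : ℝ≥0} (hθ : LipschitzOnWith K θ (Set.Icc 0 1)) :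
    ∃ σ : LipCurve X, σ.1 0 = θ 0 ∧ σ.1 1 = θ 1 ∧ length σ.1 = length θ := by
  have hp : ∀ t ∈ Set.Icc (0 : ℝ) 1, (Set.projIcc (0 : ℝ) 1 zero_le_one t : ℝ) = t :=
    fun t ht => by rw [Set.projIcc_of_mem _ ht]
  refine ⟨⟨fun t => θ (Set.projIcc (0 : ℝ) 1 zero_le_one t), K, ?_⟩, ?_, ?_, ?_⟩
  · have h := LipschitzWith.projIcc (zero_le_one (α := ℝ))
    have h2 := hθ.to_restrict.comp h
    rw [mul_one] at h2
    exact h2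
  · simp only
    rw [hp 0 (by simp)]
  · simp only
    rw [hp 1 (by simp)]
  · rw [length, length, ← setLIntegral_congr Ico_ae_eq_Icc, ← setLIntegral_congr Ico_ae_eq_Icc]
    refine setLIntegral_congr_fun measurableSet_Ico fun t ht => ?_
    refine limsup_congr ?_
    filter_upwards [Ioo_mem_nhdsGT (sub_pos.2 ht.2)] with h hh
    rw [hp t ⟨ht.1, ht.2.le⟩, hp (t + h) ⟨by linarith [ht.1, hh.1], by linarith [hh.2]⟩]

theorem sum_sub_add_sum_sub {m : ℕ} (p q : Fin (m + 1) → ℝ) :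
    ∑ i, (q i - p i) + ∑ i : Fin m, (p i.succ - q i.castSucc) = q (Fin.last m) - p 0 := by
  rw [Finset.sum_sub_distrib, Finset.sum_sub_distrib, Fin.sum_univ_castSucc q, Fin.sum_univ_succ p]
  ring

/-- In a piecewise quasiconvex space, a Lipschitz function growing at rate at most `s` along all
Lipschitz curves is `c * s`-Lipschitz. -/
theorem lipschitzWith_of_forall_curve {c : ℝ} (hX : IsPiecewiseQuasiconvex X c) (s : ℝ≥0)
    (f : X → ℝ) (L : ℝ≥0) (hf : LipschitzWith L f)
    (h : ∀ θ : LipCurve X, f (θ.1 1) - f (θ.1 0) ≤ s * θ.len) :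
    LipschitzWith (c.toNNReal * s) f := by
  have hc : 0 ≤ c := zero_le_one.trans hX.1
  have key : ∀ x y, f y - f x ≤ s * (c * dist x y) := by
    intro x y
    refine le_of_forall_pos_le_add fun ε hε => ?_
    -- The a priori constant `L` serves only to bound the change of `f` across the gaps, by `L * ε /
    -- (L + 1) ≤ ε`.
    obtain ⟨m, p, q, hd, θ, hθ, hl⟩ := hX.2 x y (ε / (L + 1)) (by positivity)
    have hσ : ∀ i, ∃ σ : LipCurve X, σ.1 0 = p i ∧ σ.1 1 = q i ∧ length σ.1 = length (θ i) := by
      intro i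
      obtain ⟨⟨K, hK⟩, h0, h1⟩ := hθ i
      simpa [h0, h1] using exists_lipCurve hK
    choose σ hσ0 hσ1 hσl using hσ
    have hlen : ∑ i, ((σ i).len : ℝ) ≤ c * dist x y := by
      have e : ∑ i, length (θ i) = ((∑ i, (σ i).len : ℝ≥0) : ℝ≥0∞) := by
        push_cast
        simp only [LipCurve.coe_len, hσl]
      rw [e, ENNReal.coe_nnreal_eq, ENNReal.ofReal_le_ofReal_iff (by positivity)] at hl
      simpa using hl
    have h1 : ∑ i, (f (q i) - f (p i)) ≤ s * ∑ i, ((σ i).len : ℝ) := by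
      rw [Finset.mul_sum]
      exact Finset.sum_le_sum fun i _ => by simpa [hσ0, hσ1] using h (σ i)
    have hLip : ∀ u v, f u - f v ≤ L * dist u v := fun u v =>
      (le_abs_self _).trans (hf.dist_le_mul u v)
    have h2 : ∑ i : Fin m, (f (p i.succ) - f (q i.castSucc)) ≤
        L * ∑ i : Fin m, dist (p i.succ) (q i.castSucc) := by
      rw [Finset.mul_sum]
      exact Finset.sum_le_sum fun i _ => hLip _ _
    have h3 := sum_sub_add_sum_sub (fun i => f (p i)) (fun i => f (q i))
    have h4 := hLip (p 0) x
    have h5 := hLip y (q (Fin.last m))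
    rw [dist_comm] at h4 h5
    have h6 := mul_le_mul_of_nonneg_left hd.le L.coe_nonneg
    have h7 : (L : ℝ) * (ε / (L + 1)) ≤ ε := by
      rw [mul_div_assoc', div_le_iff₀ (by positivity)]
      nlinarith
    have h8 := mul_le_mul_of_nonneg_left hlen s.coe_nonneg
    simp only [mul_add] at h6
    linarith
  refine LipschitzWith.of_dist_le_mul fun x y => ?_
  rw [Real.dist_eq, NNReal.coe_mul, Real.coe_toNNReal c hc]
  have h1 := key x y
  have h2 := key y x
  rw [dist_comm] at h2
  refine abs_le.2 ⟨by linarith, by linarith⟩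

end

/-! ### Representing functionals by boundaries of curves. -/

/-- The sequentially continuous linear functionals on `Lip X` of norm at most `M`. -/
def boundedFunctionals (X : Type*) [MetricSpace X] (M : ℝ) : Set (Lip X →ₗ[ℝ] ℝ) :=
  {φ | IsSeqContinuous φ ∧
    ∀ (f : Lip X) (K : ℝ≥0), LipschitzWith K (f : X → ℝ) → |φ f| ≤ M * K}

variable {X : Type*} [MetricSpace X] [MeasurableSpace X] [BorelSpace X]

theorem exists_curve_sub_lt {c : ℝ} (hX : IsPiecewiseQuasiconvex X c) (φ : Lip X →ₗ[ℝ] ℝ) {M : ℝ}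
    (hM : 0 < M) (hφ : ∀ (f : Lip X) (K : ℝ≥0), LipschitzWith K (f : X → ℝ) → |φ f| ≤ M * K)
    {ε : ℝ} (hε : 0 < ε) (x₀ : X) (f : Lip X) (hf : LipschitzWith 1 (f : X → ℝ)) :
    ∃ (a : ℝ≥0) (θ : LipCurve X), a * θ.len ≤ c * M ∧
      φ f - a * ((f : X → ℝ) (θ.1 1) - (f : X → ℝ) (θ.1 0)) < ε := by
  have hcM : 0 < c * M := mul_pos (zero_lt_one.trans_le hX.1) hM
  by_contra! H
  -- A curve of weight zero gives this, so that the rate `s` below is nonnegative.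
  have h0 : ε ≤ φ f := by
    simpa using H 0 ⟨fun _ => x₀, 0, LipschitzWith.const x₀⟩ (by simpa using hcM.le)
  obtain ⟨s, hs⟩ : ∃ s : ℝ≥0, (s : ℝ) = (φ f - ε) / (c * M) :=
    ⟨_, Real.coe_toNNReal _ (div_nonneg (sub_nonneg.2 h0) hcM.le)⟩
  have hl := lipschitzWith_of_forall_curve hX s f 1 hf fun θ => by
    rcases eq_or_lt_of_le θ.len.coe_nonneg with h | h
    · have := (le_abs_self _).trans (θ.abs_sub_le_len f 1 hf)
      rw [← h] at this ⊢
      simpa using this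
    -- The largest weight allowed for `θ`; a curve of zero length was handled above, as `f` does not
    -- change along it.
    · obtain ⟨a, ha⟩ : ∃ a : ℝ≥0, (a : ℝ) = c * M / θ.len :=
        ⟨_, Real.coe_toNNReal _ (div_pos hcM h).le⟩
      have := H a θ (by rw [ha, div_mul_cancel₀ _ h.ne'])
      rw [hs, div_mul_eq_mul_div, le_div_iff₀ hcM]
      rw [ha, div_mul_eq_mul_div, le_sub_comm, div_le_iff₀ h] at this
      linarith
  have h1 := (le_abs_self _).trans (hφ f _ hl)
  rw [NNReal.coe_mul, Real.coe_toNNReal _ (zero_le_one.trans hX.1), hs] at h1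
  have h2 : M * (c * ((φ f - ε) / (c * M))) = φ f - ε := by
    have : 0 < c := zero_lt_one.trans_le hX.1
    field_simp
  linarith

/-- A sequentially continuous functional of norm at most `M` is approximated by boundaries of finite
sums of curves of total length at most `c * M`. -/
theorem exists_finite_curves {c : ℝ} (hX : IsPiecewiseQuasiconvex X c)
    [TopologicalSpace.SeparableSpace X] (x₀ : X) (φ : Lip X →ₗ[ℝ] ℝ) (hcont : IsSeqContinuous φ)
    {M : ℝ} (hM : 0 < M)
    (hφ : ∀ (f : Lip X) (K : ℝ≥0), LipschitzWith K (f : X → ℝ) → |φ f| ≤ M * K)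
    {ε : ℝ} (hε : 0 < ε) :
    ∃ (n : ℕ) (a : Fin n → ℝ≥0) (θ : Fin n → LipCurve X), ∑ i, (a i : ℝ) * (θ i).len ≤ c * M ∧
      ∀ (f : Lip X) (K : ℝ≥0), LipschitzWith K (f : X → ℝ) →
        |φ f - ∑ i, (a i : ℝ) * ((f : X → ℝ) ((θ i).1 1) - (f : X → ℝ) ((θ i).1 0))| ≤ ε * K := by
  -- An arbitrary linear extension lets the minimax argument run in the product space `X → ℝ`; only
  -- its values on Lipschitz functions matter.
  obtain ⟨ψ, hψ⟩ := LinearMap.exists_extend φ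
  replace hψ : ∀ f : Lip X, ψ f = φ f := fun f => LinearMap.congr_fun hψ f
  have hψc := hcont.continuousOn_pointedLip ψ hψ x₀
  let G : Set ((X → ℝ) → ℝ) := {m | ∃ (a : ℝ≥0) (θ : LipCurve X), a * θ.len ≤ c * M ∧
    m = fun f : X → ℝ => (a : ℝ) * (f (θ.1 1) - f (θ.1 0))}
  have hull : ∀ m ∈ convexHull ℝ G, ∃ (n : ℕ) (a : Fin n → ℝ≥0) (θ : Fin n → LipCurve X),
      ∑ i, (a i : ℝ) * (θ i).len ≤ c * M ∧
      ∀ f : X → ℝ, m f = ∑ i, (a i : ℝ) * (f ((θ i).1 1) - f ((θ i).1 0)) := by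
    intro m hm
    obtain ⟨ι, _, w, z, hw0, hw1, hz, rfl⟩ := mem_convexHull_iff_exists_fintype.1 hm
    choose a θ hl hz using hz
    lift w to ι → ℝ≥0 using hw0
    let e := Fintype.equivFin ι
    refine ⟨Fintype.card ι, fun j => w (e.symm j) * a (e.symm j), fun j => θ (e.symm j), ?_,
      fun f => ?_⟩
    · rw [e.symm.sum_comp fun i => ((w i * a i : ℝ≥0) : ℝ) * (θ i).len]
      calc _ ≤ ∑ i, (w i : ℝ) * (c * M) := Finset.sum_le_sum fun i _ => by
            rw [NNReal.coe_mul, mul_assoc]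
            exact mul_le_mul_of_nonneg_left (hl i) (w i).coe_nonneg
        _ = c * M := by rw [← Finset.sum_mul, hw1, one_mul]
    · rw [e.symm.sum_comp fun i => ((w i * a i : ℝ≥0) : ℝ) * (f ((θ i).1 1) - f ((θ i).1 0))]
      simp [hz, mul_assoc]
  have hGc : ∀ m ∈ convexHull ℝ G, Continuous m := by
    intro m hm
    obtain ⟨n, a, θ, -, e⟩ := hull m hm
    rw [show m = _ from funext e]
    fun_prop
  have hGl : ∀ m ∈ convexHull ℝ G, ∀ (s t : ℝ) (f g : X → ℝ),
      m (s • f + t • g) = s * m f + t * m g := by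
    intro m hm s t f g
    obtain ⟨n, a, θ, -, e⟩ := hull m hm
    simp only [e, Finset.mul_sum, ← Finset.sum_add_distrib]
    refine Finset.sum_congr rfl fun i _ => ?_
    simp only [Pi.add_apply, Pi.smul_apply, smul_eq_mul]
    ring
  have hne : (pointedLip x₀).Nonempty := ⟨fun _ => 0, LipschitzWith.const' 0, rfl⟩
  -- Each `f` has its own good curve, which stays good near `f` by continuity; compactness leaves
  -- finitely many candidates.
  obtain ⟨S, hSG, hSfin, hS⟩ : ∃ S ⊆ G, S.Finite ∧
      ∀ f ∈ pointedLip x₀, ∃ m ∈ S, -ε < m f - ψ f := by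
    have hcov : ∀ f ∈ pointedLip x₀, ∃ m ∈ G, -ε < m f - ψ f := by
      intro f hf
      obtain ⟨a, θ, hl, h⟩ := exists_curve_sub_lt hX φ hM hφ hε x₀ ⟨f, 1, hf.1⟩ hf.1
      refine ⟨_, ⟨a, θ, hl, rfl⟩, ?_⟩
      rw [← hψ] at h
      simp only at h ⊢
      linarith
    have hK := isCompact_pointedLip x₀
    choose! m hmG hm using hcov
    obtain ⟨t, ht, hcovt⟩ := hK.elim_nhdsWithin_subcover (fun f => {g | -ε < m f g - ψ g})
      fun f hf => (((hGc _ (subset_convexHull ℝ G (hmG f hf))).continuousOn.sub hψc) f hf)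
        (lt_mem_nhds (hm f hf))
    refine ⟨m '' t, ?_, t.finite_toSet.image _, fun f hf => ?_⟩
    · rintro _ ⟨f, hf, rfl⟩
      exact hmG f (ht f hf)
    · obtain ⟨g, hg, hfg⟩ := Set.mem_iUnion₂.1 (hcovt hf)
      exact ⟨m g, ⟨g, hg, rfl⟩, hfg⟩
  -- Minimax exchanges the quantifiers: a single element of the convex hull beats `-ε` on all of
  -- `pointedLip x₀`. The payoff is affine in both variables.
  obtain ⟨m, hmG, hm⟩ := Sion.exists_lt_iInf_of_lt_iInf_of_finite (X := pointedLip x₀)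
    (Y := convexHull ℝ G) (f := fun f m => m f - ψ f) (t := -ε) hne (isCompact_pointedLip x₀)
    (fun m hm => ((hGc m hm).continuousOn.sub hψc).lowerSemicontinuousOn)
    (fun m hm => ConvexOn.quasiconvexOn ⟨convex_pointedLip x₀, fun f _ g _ s t _ _ _ => by
      simp only [hGl m hm, map_add, map_smul, smul_eq_mul]
      apply le_of_eq
      ring⟩)
    (convex_convexHull ℝ G)
    (fun f _ => ((continuous_apply f).sub continuous_const).continuousOn.upperSemicontinuousOn)
    (fun f _ => ConcaveOn.quasiconcaveOn ⟨convex_convexHull ℝ G, fun m _ m' _ s t _ _ hst => by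
      simp only [Pi.add_apply, Pi.smul_apply, smul_eq_mul]
      apply le_of_eq
      have : ψ f = (s + t) * ψ f := by rw [hst, one_mul]
      linear_combination this⟩)
    (convex_pointedLip x₀) hSfin (hSG.trans (subset_convexHull ℝ G)) hS
  obtain ⟨n, a, θ, hl, e⟩ := hull m hmG
  refine ⟨n, a, θ, hl, fun f K hK => ?_⟩
  have hconst : ∀ r : ℝ, φ ⟨fun _ => r, 0, LipschitzWith.const r⟩ = 0 := fun r => by
    simpa using hφ ⟨fun _ => r, 0, LipschitzWith.const r⟩ 0 (LipschitzWith.const r)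
  have key : ∀ (f : Lip X) (K : ℝ≥0), 0 < K → LipschitzWith K (f : X → ℝ) →
      φ f - ∑ i, (a i : ℝ) * ((f : X → ℝ) ((θ i).1 1) - (f : X → ℝ) ((θ i).1 0)) ≤ ε * K := by
    intro f K hK0 hK
    have hK0' : (0 : ℝ) < K := hK0
    let g : Lip X := (K : ℝ)⁻¹ • (f - ⟨fun _ => (f : X → ℝ) x₀, 0, LipschitzWith.const _⟩)
    have hg : (g : X → ℝ) = fun x => (K : ℝ)⁻¹ * ((f : X → ℝ) x - (f : X → ℝ) x₀) := rfl
    have hgp : (g : X → ℝ) ∈ pointedLip x₀ := by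
      refine ⟨LipschitzWith.of_dist_le_mul fun x y => ?_, by simp [hg]⟩
      rw [hg, Real.dist_eq, ← mul_sub, sub_sub_sub_cancel_right, abs_mul, abs_inv, NNReal.abs_eq,
        NNReal.coe_one, one_mul, inv_mul_le_iff₀ hK0']
      exact hK.dist_le_mul x y
    have h1 := hm _ hgp
    have h2 : ψ g = (K : ℝ)⁻¹ * φ f := by
      rw [hψ, map_smul, map_sub, hconst, sub_zero, smul_eq_mul]
    have h3 : m g = (K : ℝ)⁻¹ *
        ∑ i, (a i : ℝ) * ((f : X → ℝ) ((θ i).1 1) - (f : X → ℝ) ((θ i).1 0)) := by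
      rw [e, Finset.mul_sum]
      refine Finset.sum_congr rfl fun i _ => ?_
      rw [hg]
      ring
    rw [h2, h3, ← mul_sub, neg_lt, ← mul_neg, neg_sub, inv_mul_lt_iff₀ hK0', mul_comm] at h1
    exact h1.le
  -- Normalising needs a positive constant, and `K` may be zero, so it is enlarged by `η / ε`. The
  -- lower bound comes from `-f`.
  refine le_of_forall_pos_le_add fun η hη => ?_
  obtain ⟨r, hr⟩ : ∃ r : ℝ≥0, (r : ℝ) = η / ε := ⟨_, Real.coe_toNNReal _ (div_pos hη hε).le⟩
  have hr0 : 0 < r := by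
    rw [← NNReal.coe_pos, hr]
    positivity
  have hK' : LipschitzWith (K + r) (f : X → ℝ) := hK.weaken le_self_add
  have hKr : ε * ((K + r : ℝ≥0) : ℝ) = ε * K + η := by
    rw [NNReal.coe_add, hr]
    field_simp
  have h1 := key f (K + r) (by positivity) hK'
  have h2 := key (-f) (K + r) (by positivity) hK'.neg
  have h3 : ∑ i, (a i : ℝ) * (((-f : Lip X) : X → ℝ) ((θ i).1 1) -
      ((-f : Lip X) : X → ℝ) ((θ i).1 0)) =
      -∑ i, (a i : ℝ) * ((f : X → ℝ) ((θ i).1 1) - (f : X → ℝ) ((θ i).1 0)) := by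
    rw [← Finset.sum_neg_distrib]
    refine Finset.sum_congr rfl fun i _ => ?_
    simp only [Submodule.coe_neg, Pi.neg_apply]
    ring
  rw [h3, map_neg] at h2
  rw [← hKr]
  exact abs_le.2 ⟨by linarith, h1⟩

/-- The subtracted sum is a finite combination of point evaluations, so the remainder stays
sequentially continuous and the approximation can be repeated on it. -/
theorem exists_finite_curves_remainder {c : ℝ} (hX : IsPiecewiseQuasiconvex X c)
    [TopologicalSpace.SeparableSpace X] (x₀ : X) {M ε : ℝ} (hM : 0 < M) (hε : 0 < ε)
    (φ : boundedFunctionals X M) :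
    ∃ (n : ℕ) (a : Fin n → ℝ≥0) (θ : Fin n → LipCurve X) (φ' : boundedFunctionals X ε),
      ∑ i, (a i : ℝ) * (θ i).len ≤ c * M ∧ ∀ f : Lip X,
        ∑ i, (a i : ℝ) * ((f : X → ℝ) ((θ i).1 1) - (f : X → ℝ) ((θ i).1 0)) =
          φ.1 f - φ'.1 f := by
  obtain ⟨n, a, θ, hl, h⟩ := exists_finite_curves hX x₀ φ.1 φ.2.1 hM φ.2.2 hε
  let m : Lip X →ₗ[ℝ] ℝ :=
    { toFun := fun f => ∑ i, (a i : ℝ) * ((f : X → ℝ) ((θ i).1 1) - (f : X → ℝ) ((θ i).1 0))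
      map_add' := fun f g => by
        rw [← Finset.sum_add_distrib]
        refine Finset.sum_congr rfl fun i _ => ?_
        simp only [Submodule.coe_add, Pi.add_apply]
        ring
      map_smul' := fun r f => by
        rw [RingHom.id_apply, smul_eq_mul, Finset.mul_sum]
        refine Finset.sum_congr rfl fun i _ => ?_
        simp only [Submodule.coe_smul, Pi.smul_apply, smul_eq_mul]
        ring }
  refine ⟨n, a, θ, ⟨φ.1 - m, fun f fs C hC hlim => ?_, fun f K hK => h f K hK⟩, hl, fun f => ?_⟩
  · have hm : Tendsto (fun j => m (fs j)) atTop (𝓝 (m f)) :=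
      tendsto_finsetSum Finset.univ fun i _ =>
        ((hlim ((θ i).1 1)).sub (hlim ((θ i).1 0))).const_mul (a i : ℝ)
    exact (φ.2.1 f fs C hC hlim).sub hm
  · rw [LinearMap.sub_apply, sub_sub_cancel]
    rfl

/-- A sequentially continuous functional of norm at most `M` is the boundary of a countable sum of
curves of total length at most `c * (1 + δ) * M`. -/
theorem exists_countable_curves {c : ℝ} (hX : IsPiecewiseQuasiconvex X c)
    [TopologicalSpace.SeparableSpace X] (x₀ : X) {M : ℝ} (hM : 0 < M)
    (φ : boundedFunctionals X M) {δ : ℝ} (hδ : 0 < δ) :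
    ∃ (n : ℕ → ℕ) (a : (Σ k, Fin (n k)) → ℝ≥0) (θ : (Σ k, Fin (n k)) → LipCurve X)
      (_ : Summable fun i => a i * (θ i).len),
      ((∑' i, a i * (θ i).len : ℝ≥0) : ℝ≥0∞) ≤ ENNReal.ofReal (c * (1 + δ) * M) ∧
      ∀ f : Lip X, φ.1 f =
        ∑' i, (a i : ℝ) * ((f : X → ℝ) ((θ i).1 1) - (f : X → ℝ) ((θ i).1 0)) := by
  have hc : 0 ≤ c := zero_le_one.trans hX.1
  -- Norm bounds for the successive remainders: `M`, then `δM/2, δM/4, …`, with total `(1 + δ) * M`.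
  -- Stage `k` uses curves of mass at most `c * r k`.
  let r : ℕ → ℝ := fun k => Nat.casesOn k M fun k => δ * M / 2 / 2 ^ k
  have hr : ∀ k, 0 < r k := by
    rintro (_ | k)
    · exact hM
    · change 0 < δ * M / 2 / 2 ^ k
      positivity
  have hrsum : HasSum r (M + δ * M) := HasSum.zero_add (hasSum_geometric_two' (δ * M))
  have step := fun (k : ℕ) (φ : boundedFunctionals X (r k)) =>
    exists_finite_curves_remainder hX x₀ (hr k) (hr (k + 1)) φ
  choose n a θ φ' hl hφ' using step
  let Φ : ∀ k, boundedFunctionals X (r k) := fun k => Nat.rec φ (fun k ψ => φ' k ψ) k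
  have hΦ : ∀ (k : ℕ) (f : Lip X), ∑ i, (a k (Φ k) i : ℝ) *
      ((f : X → ℝ) ((θ k (Φ k) i).1 1) - (f : X → ℝ) ((θ k (Φ k) i).1 0)) =
      (Φ k).1 f - (Φ (k + 1)).1 f := fun k f => hφ' k (Φ k) f
  let A : (Σ k, Fin (n k (Φ k))) → ℝ≥0 := fun i => a i.1 (Φ i.1) i.2
  let Θ : (Σ k, Fin (n k (Φ k))) → LipCurve X := fun i => θ i.1 (Φ i.1) i.2
  have hle : ∑' i, ((A i * (Θ i).len : ℝ≥0) : ℝ≥0∞) ≤ ENNReal.ofReal (c * (1 + δ) * M) := by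
    rw [ENNReal.tsum_sigma']
    have hs := (hrsum.mul_left c)
    calc _ ≤ ∑' k, ENNReal.ofReal (c * r k) := ENNReal.tsum_le_tsum fun k => by
          rw [tsum_fintype, ← ENNReal.ofNNReal_finsetSum, ENNReal.coe_nnreal_eq]
          refine ENNReal.ofReal_le_ofReal ?_
          simpa using hl k (Φ k)
      _ = ENNReal.ofReal (c * (M + δ * M)) := by
          rw [← ENNReal.ofReal_tsum_of_nonneg (fun k => mul_nonneg hc (hr k).le) hs.summable,
            hs.tsum_eq]
      _ = _ := by
          congr 1
          ring
  have hsum : Summable fun i => A i * (Θ i).len :=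
    ENNReal.tsum_coe_ne_top_iff_summable.1 (ne_top_of_le_ne_top ENNReal.ofReal_ne_top hle)
  refine ⟨_, A, Θ, hsum, (ENNReal.coe_tsum hsum).trans_le hle, fun f => ?_⟩
  obtain ⟨K, hK⟩ := f.2
  have h1 : Summable fun i => (A i : ℝ) *
      ((f : X → ℝ) ((Θ i).1 1) - (f : X → ℝ) ((Θ i).1 0)) := by
    simpa only [LipCurve.form_one] using summable_mul_form A Θ hsum (oneB X) f
  have h2 : HasSum (fun k => (Φ k).1 f - (Φ (k + 1)).1 f) (∑' i, (A i : ℝ) *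
      ((f : X → ℝ) ((Θ i).1 1) - (f : X → ℝ) ((Θ i).1 0))) :=
    h1.hasSum.sigma fun k => by
      rw [← hΦ k f]
      exact hasSum_fintype _
  -- The stages telescope to `Φ 0 - Φ k`, and the remainder tends to zero with `r k`.
  have h3 : Tendsto (fun k => (Φ k).1 f) atTop (𝓝 0) := by
    refine squeeze_zero_norm (fun k => (Φ k).2.2 f K hK) ?_
    simpa using hrsum.summable.tendsto_atTop_zero.mul_const (K : ℝ)
  have h4 := h2.tendsto_sum_nat
  simp only [Finset.sum_range_sub'] at h4
  have h5 : Tendsto (fun k => (Φ 0).1 f - (Φ k).1 f) atTop (𝓝 ((Φ 0).1 f - 0)) :=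
    h3.const_sub _
  rw [sub_zero] at h5
  exact tendsto_nhds_unique h5 h4

/-! ### The boundary of a current as a bounded functional, and the conclusion. -/

namespace Current₁

theorem boundaryKR_ne_top (T : Current₁ X) : T.boundaryKR ≠ ∞ := by
  obtain ⟨μ, hμ, hb⟩ := T.finite_mass
  refine ne_top_of_le_ne_top (measure_ne_top μ Set.univ) (iSup₂_le fun f hf => ?_)
  refine ENNReal.ofReal_le_of_le_toReal ((le_abs_self _).trans ?_)
  simpa [boundary, oneB, Measure.real] using hb (oneB X) f 1 hf

theorem boundary_le_of_lipschitzWith_one (T : Current₁ X) (f : Lip X)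
    (hf : LipschitzWith 1 (f : X → ℝ)) : T.boundary f ≤ T.boundaryKR.toReal :=
  (ENNReal.ofReal_le_iff_le_toReal T.boundaryKR_ne_top).1
    (le_iSup₂ (f := fun (f : Lip X) (_ : LipschitzWith 1 (f : X → ℝ)) =>
      ENNReal.ofReal (T.boundary f)) f hf)

theorem boundary_mem_boundedFunctionals (T : Current₁ X) :
    T.boundary ∈ boundedFunctionals X T.boundaryKR.toReal := by
  refine ⟨fun f fs C hC hlim => T.continuity (oneB X) f fs C hC hlim, fun f K hK => ?_⟩
  -- Scaling to Lipschitz constant `1` is impossible for `K = 0`; there the mass bound itself gives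
  -- zero.
  rcases eq_or_lt_of_le (zero_le : 0 ≤ K) with rfl | hK0
  · obtain ⟨μ, hμ, hb⟩ := T.finite_mass
    simpa [boundary] using hb (oneB X) f 0 hK
  have hK0' : (0 : ℝ) < K := hK0
  have h : ∀ f : Lip X, LipschitzWith K (f : X → ℝ) →
      T.boundary f ≤ T.boundaryKR.toReal * K := by
    intro f hK
    have h1 := T.boundary_le_of_lipschitzWith_one ((K : ℝ)⁻¹ • f)
      (LipschitzWith.of_dist_le_mul fun x y => by
        rw [NNReal.coe_one, one_mul, Submodule.coe_smul, Pi.smul_apply, Pi.smul_apply, dist_smul₀,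
          norm_inv, Real.norm_eq_abs, NNReal.abs_eq, inv_mul_le_iff₀ hK0']
        exact hK.dist_le_mul x y)
    rwa [map_smul, smul_eq_mul, inv_mul_le_iff₀ hK0', mul_comm] at h1
  have h2 := h (-f) hK.neg
  rw [map_neg] at h2
  exact abs_le.2 ⟨by linarith, h f hK⟩

end Current₁
end MetricCurrents

end

theorem mainTheorem7 {X : Type*} [MetricSpace X] [TopologicalSpace.SeparableSpace X]
    [MeasurableSpace X] [BorelSpace X] (c : ℝ)
    (hX : MetricCurrents.IsPiecewiseQuasiconvex X c)
    (T : MetricCurrents.Current₁ X) (δ : ℝ) (hδ : δ ∈ Set.Ioo (0 : ℝ) 1) :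
    ∃ R : MetricCurrents.Current₁ X, R.IsRectifiable ∧ R.boundary = T.boundary ∧
      R.mass ≤ ENNReal.ofReal (c * (1 + δ)) * T.boundaryKR := by
  open MetricCurrents in
  have hT := T.boundary_mem_boundedFunctionals
  have hc : 0 ≤ c := zero_le_one.trans hX.1
  -- The construction needs a base point and a positive norm. Otherwise the boundary vanishes and
  -- the empty sum serves as `R`.
  by_cases h : Nonempty X ∧ 0 < T.boundaryKR.toReal
  · obtain ⟨⟨x₀⟩, hM⟩ := h
    obtain ⟨n, a, θ, hs, hl, hb⟩ := exists_countable_curves hX x₀ hM ⟨_, hT⟩ hδ.1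
    refine ⟨sumCurrent a θ hs, isRectifiable_sumCurrent a θ hs, LinearMap.ext fun f => ?_,
      (mass_sumCurrent_le a θ hs).trans (hl.trans (le_of_eq ?_))⟩
    · rw [boundary_sumCurrent, ← hb f]
    · rw [ENNReal.ofReal_mul (mul_nonneg hc (by linarith [hδ.1])),
        ENNReal.ofReal_toReal T.boundaryKR_ne_top]
  · have h0 : ∀ f, T.boundary f = 0 := by
      intro f
      obtain ⟨K, hK⟩ := f.2
      rcases isEmpty_or_nonempty X with hE | hE
      · simpa using hT.2 f 0 fun x => hE.elim x
      · have : T.boundaryKR.toReal = 0 :=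
          le_antisymm (not_lt.1 fun h' => h ⟨hE, h'⟩) ENNReal.toReal_nonneg
        simpa [this] using hT.2 f K hK
    have hs : Summable fun i : Fin 0 => (Fin.elim0 i : ℝ≥0) * (Fin.elim0 i : LipCurve X).len :=
      (hasSum_fintype _).summable
    refine ⟨sumCurrent _ _ hs, isRectifiable_sumCurrent _ _ hs, LinearMap.ext fun f => ?_,
      (mass_sumCurrent_le _ _ hs).trans ?_⟩
    · rw [boundary_sumCurrent, h0, tsum_empty]
    · simp
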